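/- Let $\mathcal H$ be a finite-dimensional or separable complex Hilbert space and $L$ a finite set of locations. Consider a deterministic quantum program with exit: every $l\in L$ carries a trace-preserving super-operator $\mathcal E_l$ on $\mathcal H$ and a measurement $\{M_{l,0},\dots,M_{l,N}\}$, $\sum_j M_{l,j}^\dagger M_{l,j}=I$; there is a next-location map $f:\{0,\dots,N\}\times L\to L$; and there is an exit location $l_e$ with $\mathcal E_{l_e}=\mathrm{id}$, $\{M_{l_e,j}\}_j=\{I,0,\dots,0\}$ and $f(j,l_e)=l_e$ for all $j$. One step of the program is the super-operator on $\mathcal H\otimes\mathbb C^L$ $$\mathcal E_\pi(\sigma)=\sum_{j=0}^N\sum_{l\in L}M_{l,j}\,\mathcal E_l(\langle l|\sigma|l\rangle)\,M_{l,j}^\dagger\otimes|f(j,l)\rangle\langle f(j,l)| .$$ Let $M_0=I\otimes|l_e\rangle\langle l_e|$, $M_1=I\otimes\sum_{l\ne l_e}|l\rangle\langle l|$, $S=\mathcal E_\pi$, and let $\pi$ be the while-program $\mathbf{while}\ \mathcal M=1\ \mathbf{do}\ S\ \mathbf{od}$ with $\mathcal M=\{M_0,M_1\}$. Let $AP$ be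 the set of projections $\sum_l P_l\otimes|l\rangle\langle l|$ (identified with closed subspaces), write $\sigma\models p$ if $\operatorname{supp}\sigma\subseteq p$, and let $\mathcal D$ be the set of partial density operators on $\mathcal H\otimes\mathbb C^L$ (positive, trace $\le1$). For a program $T$ with denotational semantics $[\![T]\!]$, the triple $\{P\}T\{Q\}$ is true in the sense of partial correctness if $[\![T]\!](\rho)\models Q$ for all $\rho\in\mathcal D$ with $\rho\models P$, and in the sense of total correctness if moreover $\operatorname{tr}[\![T]\!](\rho)=\operatorname{tr}\rho$ for these $\rho$. For $p,q\in AP$ put $r(p,q)=\operatorname{supp}[(M_0\wedge q)+(M_1\wedge p)]$. A function $t:\mathcal D\to\mathbb N$ is an $(r,\epsilon)$-ranking function of the loop if for all $\sigma\in\mathcal D$ with $\sigma\models r$: $[\![S]\!](M_1\sigma M_1)\models r$; $t([\![S]\!](M_1\sigma M_1))\le t(\sigma)$; and $\operatorname{tr}\sigma\ge\epsilon$ implies $t([\![S]\!](M_1\sigma M_1))<t(\sigma)$. Consider the rules $$(\square)\ \frac{\{p\}S\{r(p,q)\}}{\{r(p,q)\}\,\pi\,\{q\}}\qquad(\tilde\lozenge)\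 \frac{\{p\}S\{r(p,q)\}\quad\text{for every }\epsilon>0,\ t_\epsilon\text{ is an }(r(p,q),\epsilon)\text{-ranking function}}{\{r(p,q)\}\,\pi\,\{q\}}$$ each together with the consequence rule for triples (with respect to inclusion of subspaces) and the true triples about the loop-free statement $S$, for assertions in $AP$. For $P,q\in AP$ and a temporal formula $\phi$, say that $\phi$ holds from $P$ if every sequence $\sigma_k=\mathcal E_\pi^k(\sigma_0)$, $\sigma_0=\sum_l\rho_l\otimes|l\rangle\langle l|$ a density operator with $\sigma_0\models P$, satisfies $\phi$; here $\square q$ means $\sigma_k\models q$ for all $k$, and $\tilde\lozenge q$ means that for every $\delta>0$ there is $k$ with $\operatorname{tr}(\sigma_k q)>1-\delta$. Then for all $P,q\in AP$ these proof systems are sound and relatively complete: 1. $\{P\}\pi\{q\}$ is derivable with $(\square)$ if and only if it is true in the sense of partial correctness, if and only if $\square\,(M_1+M_0\wedge q)$ holds from $P$. In particular, if $M_1\le q$, that is, $q=\sum_{l\ne l_e}I\otimes|l\rangle\langle l|+Q\otimes|l_e\rangle\langle l_e|$, then it is derivable if and only if $\square q$ holds from $P$. 2. $\{P\}\pi\{q\}$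 is derivable with $(\tilde\lozenge)$ if and only if it is true in the sense of total correctness, if and only if $\tilde\lozenge\,(M_0\wedge q)$ holds from $P$. In particular, if $q\le M_0$, that is, $q=Q\otimes|l_e\rangle\langle l_e|$, then it is derivable if and only if $\tilde\lozenge q$ holds from $P$. -/

import Mathlib

open scoped InnerProductSpace

noncomputable section

namespace QTLogic

/-! ### Operators, trace, states, support -/

/-- Bounded operators on a Hilbert space. -/
abbrev Op (E : Type*) [NormedAddCommGroup E] [InnerProductSpace ℂ E] := E →L[ℂ] E

section Hilbert

variable (E : Type*) [NormedAddCommGroup E] [InnerProductSpace ℂ E] [CompleteSpace E]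

/-- Index set of an orthonormal (Hilbert) basis of `E`. -/
def basisIndex : Set E := (exists_hilbertBasis ℂ E).choose

/-- An orthonormal (Hilbert) basis of `E`. -/
def onb : HilbertBasis (basisIndex E) ℂ E := (exists_hilbertBasis ℂ E).choose_spec.choose

variable {E}

/-- The trace `∑ᵢ ⟨eᵢ, T eᵢ⟩`. It is only used for products of a positive trace class operator
with a bounded operator, where the sum converges absolutely and does not depend on the basis. -/
def trace (T : Op E) : ℂ := ∑' i, ⟪onb E i, T (onb E i)⟫_ℂ

variable (E) in
/-- `𝒟(E)`: partial density operators, the positive trace class operators of trace at most `1`. -/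
def PartialDensity : Set (Op E) :=
  {ρ | ρ.IsPositive ∧ Summable (fun i => ⟪onb E i, ρ (onb E i)⟫_ℂ) ∧ (trace ρ).re ≤ 1}

/-- The support `{φ | ⟨φ, A φ⟩ = 0}ᗮ` of a positive operator `A`. -/
def supp (A : Op E) : ClosedSubmodule ℂ E :=
  ⟨(Submodule.span ℂ {φ : E | ⟪φ, A φ⟫_ℂ = 0})ᗮ, Submodule.isClosed_orthogonal _⟩

/-- `ρ ⊨ p`: the support of `ρ` is contained in `p`. -/
def Sat (ρ : Op E) (p : ClosedSubmodule ℂ E) : Prop := supp ρ ≤ p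

/-- The orthogonal projection onto a closed subspace. -/
def proj (p : ClosedSubmodule ℂ E) : Op E :=
  haveI : CompleteSpace p.toSubmodule := p.isClosed.completeSpace_coe
  p.toSubmodule.starProjection

/-- `A ρ A†`. -/
def sandwich {F : Type*} [NormedAddCommGroup F] [InnerProductSpace ℂ F] [CompleteSpace F]
    (A : E →L[ℂ] F) (ρ : Op E) : Op F :=
  A ∘L ρ ∘L ContinuousLinearMap.adjoint A

variable (E) in
/-- A trace preserving super-operator in Kraus form. The family of Kraus operators is countable
(finite families are padded by zeros) and `∑ₖ Eₖ† Eₖ = I`, that is,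
`∑ₖ ‖Eₖ ψ‖² = ‖ψ‖²` for all `ψ`. -/
structure Channel where
  kraus : ℕ → Op E
  tracePreserving : ∀ ψ : E, HasSum (fun k => ‖kraus k ψ‖ ^ 2) (‖ψ‖ ^ 2)

/-- `ℰ(ρ) = ∑ₖ Eₖ ρ Eₖ†`. -/
def Channel.apply (C : Channel E) (ρ : Op E) : Op E := ∑' k, sandwich (C.kraus k) ρ

/-! ### Quantum while-programs: operational and denotational semantics -/

variable (E) in
/-- Quantum while-programs: basic statements that apply a super-operator, sequential composition,
and the loop `while M = 1 do S od` guarded by a measurement with operators `M₀`, `M₁`. -/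
inductive QWhile : Type _
  | apply (𝓔 : Op E → Op E) : QWhile
  | seq (S T : QWhile) : QWhile
  | loop (M₀ M₁ : Op E) (S : QWhile) : QWhile

/-- Configurations `⟨S, ρ⟩`; `none` is the termination symbol `↓`. -/
abbrev Config (E : Type*) [NormedAddCommGroup E] [InnerProductSpace ℂ E] [CompleteSpace E] :=
  Option (QWhile E) × Op E

/-- `S ; T` with the convention `↓ ; T = T`. -/
def seqOpt (S : Option (QWhile E)) (T : QWhile E) : QWhile E :=
  match S with
  | none => T
  | some S' => .seq S' T

/-- The transitions leaving `⟨S, ρ⟩`. -/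
def transitions : QWhile E → Op E → Multiset (Config E)
  | .apply 𝓔, ρ => {(none, 𝓔 ρ)}
  | .seq S T, ρ => (transitions S ρ).map fun c => (some (seqOpt c.1 T), c.2)
  | .loop M₀ M₁ S, ρ =>
      {(none, sandwich M₀ ρ), (some (.seq S (.loop M₀ M₁ S)), sandwich M₁ ρ)}

/-- Successor configurations; a terminated configuration has none. -/
def successors : Config E → Multiset (Config E)
  | (none, _) => 0
  | (some S, ρ) => transitions S ρ

/-- Configurations reached by the computations of length `n`, with multiplicity. -/
def reached (c : Config E) : ℕ → Multiset (Config E)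
  | 0 => {c}
  | n + 1 => (reached c n).bind successors

/-- The multiset of the `ρ'` such that `⟨S, ρ⟩` reaches `⟨↓, ρ'⟩` in exactly `n` transitions. -/
def outputs (S : QWhile E) (ρ : Op E) (n : ℕ) : Multiset (Op E) :=
  ((reached (some S, ρ) n).filter fun c => c.1.isNone = true).map Prod.snd

/-- `⟦S⟧(ρ)`, the sum of the multiset of all `ρ'` with `⟨S, ρ⟩ →* ⟨↓, ρ'⟩`. -/
def denote (S : QWhile E) (ρ : Op E) : Op E := ∑' n, (outputs S ρ n).sum

/-- Partial correctness of `{P} S {Q}` in applied quantum Hoare logic. -/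
def ValidPar (S : QWhile E) (P Q : ClosedSubmodule ℂ E) : Prop :=
  ∀ ρ ∈ PartialDensity E, Sat ρ P → Sat (denote S ρ) Q

/-- Total correctness of `{P} S {Q}` in applied quantum Hoare logic. -/
def ValidTot (S : QWhile E) (P Q : ClosedSubmodule ℂ E) : Prop :=
  ∀ ρ ∈ PartialDensity E, Sat ρ P → Sat (denote S ρ) Q ∧ trace (denote S ρ) = trace ρ

/-- `t` is a `(q, ε)`-ranking function of the loop with body `S` and guard operator `M₁`. -/
def IsRanking (S : QWhile E) (M₁ : Op E) (q : ClosedSubmodule ℂ E) (ε : ℝ)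
    (t : Op E → ℕ) : Prop :=
  ∀ σ ∈ PartialDensity E, Sat σ q →
    Sat (denote S (sandwich M₁ σ)) q ∧
    t (denote S (sandwich M₁ σ)) ≤ t σ ∧
    (ε ≤ (trace σ).re → t (denote S (sandwich M₁ σ)) < t σ)

/-! ### Quantum temporal logic -/

variable (E) in
/-- Formulas of quantum temporal logic over closed subspaces. -/
inductive QTL : Type _
  | atom (p : ClosedSubmodule ℂ E) : QTL
  | almostEventually (p : ClosedSubmodule ℂ E) : QTL
  | almostUntil (q p : ClosedSubmodule ℂ E) : QTL
  | and (φ ψ : QTL) : QTL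
  | or (φ ψ : QTL) : QTL
  | next (φ : QTL) : QTL
  | untilF (ψ φ : QTL) : QTL
  | eventually (φ : QTL) : QTL
  | always (φ : QTL) : QTL

/-- `w ⊨ φ` for a sequence of states `w`. -/
def Models : (ℕ → Op E) → QTL E → Prop
  | w, .atom p => Sat (w 0) p
  | w, .almostEventually p => ∀ δ : ℝ, 0 < δ → ∃ i, 1 - δ < (trace (w i ∘L proj p)).re
  | w, .almostUntil q p => ∀ δ : ℝ, 0 < δ →
      ∃ i, 1 - δ < (trace (w i ∘L proj p)).re ∧ ∀ k < i, Sat (w k) q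
  | w, .and φ ψ => Models w φ ∧ Models w ψ
  | w, .or φ ψ => Models w φ ∨ Models w ψ
  | w, .next φ => Models (fun n => w (n + 1)) φ
  | w, .untilF ψ φ =>
      ∃ i, Models (fun n => w (n + i)) φ ∧ ∀ k < i, Models (fun n => w (n + k)) ψ
  | w, .eventually φ => ∃ i, Models (fun n => w (n + i)) φ
  | w, .always φ => ∀ i, Models (fun n => w (n + i)) φ

end Hilbert

/-! ### Deterministic quantum programs with exit -/

section Programs

variable (H : Type*) [NormedAddCommGroup H] [InnerProductSpace ℂ H] [CompleteSpace H]
variable (L : Type*) [Fintype L] [DecidableEq L]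

/-- The state space `H ⊗ ℂ^L`, realised as the Hilbert sum of copies of `H` indexed by `L`:
the vector `∑ₗ ψₗ ⊗ |l⟩` is the family `(ψₗ)`. -/
abbrev Joint := PiLp 2 (fun _ : L => H)

variable {H L}

/-- `I_H ⊗ ⟨l|`. -/
def bra (l : L) : Joint H L →L[ℂ] H := PiLp.proj 2 (fun _ : L => H) l

/-- `A ⊗ |k⟩⟨l|`. -/
def ketbra (A : Op H) (k l : L) : Op (Joint H L) :=
  ContinuousLinearMap.adjoint (bra k) ∘L A ∘L bra l

/-- The subspace of the projection `∑ₗ Pₗ ⊗ |l⟩⟨l|`. -/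
def block (P : L → ClosedSubmodule ℂ H) : ClosedSubmodule ℂ (Joint H L) :=
  ⨅ l, (P l).comap (bra l)

variable (H L) in
/-- The atomic propositions `∑ₗ Pₗ ⊗ |l⟩⟨l|`. -/
def AP : Set (ClosedSubmodule ℂ (Joint H L)) := Set.range block

variable (H L) in
/-- The states `∑ₗ ρₗ ⊗ |l⟩⟨l|` of total trace `1`. -/
def States : Set (Op (Joint H L)) :=
  {σ | ∃ ρ : L → Op H, (∀ l, ρ l ∈ PartialDensity H) ∧ ∑ l, trace (ρ l) = 1 ∧
    σ = ∑ l, ketbra (ρ l) l l}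

variable (H L) in
/-- A deterministic quantum program with exit, without its initial data: initial states and
initial locations are described by preconditions. -/
structure ExitProgram where
  /-- measurement outcomes are `0, …, N` -/
  N : ℕ
  /-- the trace preserving super-operator of each location -/
  act : L → Channel H
  /-- the measurement of each location -/
  meas : L → Fin (N + 1) → Op H
  meas_complete : ∀ l, ∑ j, ContinuousLinearMap.adjoint (meas l j) ∘L meas l j = 1
  /-- the next location -/
  goto : Fin (N + 1) → L → L
  /-- the exit location -/
  exit : L
  act_exit : ∀ ρ ∈ PartialDensity H, (act exit).apply ρ = ρ
  meas_exit : ∀ j, meas exit j = if j = 0 then 1 else 0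
  goto_exit : ∀ j, goto j exit = exit

namespace ExitProgram

variable (π : ExitProgram H L)

/-- One step of the program,
`ℰ_π(σ) = ∑ⱼ ∑ₗ (M_{l,j} ℰ_l(σ_l) M_{l,j}†) ⊗ |f(j,l)⟩⟨f(j,l)|`, where `σ_l = ⟨l|σ|l⟩`. -/
def step (σ : Op (Joint H L)) : Op (Joint H L) :=
  ∑ j, ∑ l, ketbra (sandwich (π.meas l j) ((π.act l).apply (sandwich (bra l) σ)))
    (π.goto j l) (π.goto j l)

/-- `M₀ = I_H ⊗ |l_e⟩⟨l_e|` as an operator. -/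
def M₀ : Op (Joint H L) := ketbra 1 π.exit π.exit

/-- `M₁ = I_H ⊗ ∑_{l ≠ l_e} |l⟩⟨l|` as an operator. -/
def M₁ : Op (Joint H L) := ∑ l ∈ Finset.univ.erase π.exit, ketbra 1 l l

/-- The subspace of the projection `M₀`. -/
def exitSpace : ClosedSubmodule ℂ (Joint H L) := block fun l => if l = π.exit then ⊤ else ⊥

/-- The subspace of the projection `M₁`. -/
def runSpace : ClosedSubmodule ℂ (Joint H L) := block fun l => if l = π.exit then ⊥ else ⊤

/-- The loop body `S = ℰ_π`. -/
def body : QWhile (Joint H L) := .apply π.step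

/-- The while-program form `while M = 1 do ℰ_π od`. -/
def whileForm : QWhile (Joint H L) := .loop π.M₀ π.M₁ π.body

/-- `supp[(M₀ ∧ q) + (M₁ ∧ p)]`. -/
def inv (p q : ClosedSubmodule ℂ (Joint H L)) : ClosedSubmodule ℂ (Joint H L) :=
  supp (proj (π.exitSpace ⊓ q) + proj (π.runSpace ⊓ p))

/-- `φ` is valid for the program on inputs satisfying `P`: every admissible sequence
`σ₀, ℰ_π(σ₀), ℰ_π²(σ₀), …` with `σ₀ ⊨ P` satisfies `φ`. -/
def ValidQTL (P : ClosedSubmodule ℂ (Joint H L)) (φ : QTL (Joint H L)) : Prop :=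
  ∀ w : ℕ → Op (Joint H L), w 0 ∈ States H L → Sat (w 0) P →
    (∀ i, w (i + 1) = π.step (w i)) → Models w φ

/-- The proof system for `□`: the invariant rule for the while-program, on top of the true
triples about the loop-free statement `S = ℰ_π` and the consequence rule. -/
inductive ProvesPar : QWhile (Joint H L) → ClosedSubmodule ℂ (Joint H L) →
    ClosedSubmodule ℂ (Joint H L) → Prop
  | basic {p q} : p ∈ AP H L → q ∈ AP H L → ValidPar π.body p q → ProvesPar π.body p q
  | invariant {p q} : p ∈ AP H L → q ∈ AP H L → ProvesPar π.body p (π.inv p q) →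
      ProvesPar π.whileForm (π.inv p q) q
  | conseq {S P P' Q' Q} : P ∈ AP H L → Q ∈ AP H L → P ≤ P' → ProvesPar S P' Q' → Q' ≤ Q →
      ProvesPar S P Q

/-- The proof system for `◇̃`: the rule with ranking functions for the while-program, on top of
the true triples about the loop-free statement `S = ℰ_π` and the consequence rule. -/
inductive ProvesTot : QWhile (Joint H L) → ClosedSubmodule ℂ (Joint H L) →
    ClosedSubmodule ℂ (Joint H L) → Prop
  | basic {p q} : p ∈ AP H L → q ∈ AP H L → ValidTot π.body p q → ProvesTot π.body p q
  | ranking {p q} (t : ℝ → Op (Joint H L) → ℕ) : p ∈ AP H L → q ∈ AP H L →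
      ProvesTot π.body p (π.inv p q) →
      (∀ ε : ℝ, 0 < ε → IsRanking π.body π.M₁ (π.inv p q) ε (t ε)) →
      ProvesTot π.whileForm (π.inv p q) q
  | conseq {S P P' Q' Q} : P ∈ AP H L → Q ∈ AP H L → P ≤ P' → ProvesTot S P' Q' → Q' ≤ Q →
      ProvesTot S P Q

end ExitProgram

end Programs

end QTLogic

end

noncomputable section

namespace QTLogic

open InnerProductSpace ContinuousLinearMap
open scoped ComplexOrder

/-! ### Positive trace class operators as sums of rank-one operators. -/

section Ensembles

variable {E : Type*} [NormedAddCommGroup E] [InnerProductSpace ℂ E]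
variable {F : Type*} [NormedAddCommGroup F] [InnerProductSpace ℂ F] [CompleteSpace F]
variable {I J : Type*}

/-! All conditions in the theorem are shown to be one inclusion of subspaces: `P ≤ π.wlp q` for
partial correctness, `P ≤ π.wlp q ⊓ π.terminating` for total correctness.

The working tool is the ensemble: a positive trace class operator is `∑ |ψᵢ⟩⟨ψᵢ|` with `∑ ‖ψᵢ‖² <
∞`. Its trace is `∑ ‖ψᵢ‖²`, it satisfies `p` iff every `ψᵢ` lies in `p` (`IsEnsemble.sat_iff`), and
a super-operator acts on it by applying its Kraus operators to the vectors. Satisfaction thus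
becomes linear algebra on vectors.

Let `G = loopStep` send `σ` to `ℰ_π(M₁ σ M₁)`. The loop denotes `∑ₙ M₀ Gⁿ(σ) M₀`, and since exited
mass is frozen, `ℰ_πⁿ(σ) = Gⁿ(σ) + ∑_{m<n} M₀ Gᵐ(σ) M₀` (`iterate_step_eq`). Hence the output and
the temporal sequence see the same exited pieces. All of these satisfy `q` iff `σ` satisfies the
intersection `wlp q` of iterated preimages. By telescoping, no trace is lost iff `tr Gⁿ(σ) → 0`; by
dominated convergence this says that every vector of an ensemble of `σ` terminates almost surely,
and such vectors form a closed subspace (`sat_terminating_iff`).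

Soundness propagates the invariant through `Gⁿ`; a ranking function rules out that `tr Gⁿ(σ)` stays
above some `ε`. For completeness the weakest precondition itself serves as `p`. It is in `AP`
because each Kraus operator of a step reads a single location. The ranking function counts
iterations until the remaining trace is below `ε`. -/

/-- `ρ = ∑ᵢ |ψᵢ⟩⟨ψᵢ|` with `∑ᵢ ‖ψᵢ‖² < ∞`. -/
structure IsEnsemble (ρ : Op E) (ψ : I → E) : Prop where
  summable : Summable fun i => ‖ψ i‖ ^ 2
  hasSum : HasSum (fun i => rankOne ℂ (ψ i) (ψ i)) ρ

theorem summable_rankOne [CompleteSpace E] {ψ : I → E} (h : Summable fun i => ‖ψ i‖ ^ 2) :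
    Summable fun i => rankOne ℂ (ψ i) (ψ i) :=
  .of_norm (by simpa [← sq] using h)

theorem isEnsemble_rankOne (ψ : E) : IsEnsemble (rankOne ℂ ψ ψ) fun _ : Unit => ψ where
  summable := (hasSum_fintype _).summable
  hasSum := by simp

/-- Parseval for each `χ i`, then summation over `i`; this joint summability is what licenses
interchanging the ensemble sum with the basis sum of a trace. -/
theorem summable_norm_inner_sq {B : Type*} (e : HilbertBasis B ℂ E) {χ : I → E}
    (h : Summable fun i => ‖χ i‖ ^ 2) :
    Summable fun x : I × B => ‖⟪χ x.1, e x.2⟫_ℂ‖ ^ 2 := by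
  have key : ∀ v : E, HasSum (fun b => ‖⟪v, e b⟫_ℂ‖ ^ 2) (‖v‖ ^ 2) := fun v => by
    have := (e.hasSum_inner_mul_inner v v).mapL Complex.reCLM
    convert this using 1
    · ext b
      rw [← inner_conj_symm (e b) v, RCLike.mul_conj]
      simp [← Complex.ofReal_pow]
    · simp [inner_self_eq_norm_sq_to_K, ← Complex.ofReal_pow]
  rw [summable_prod_of_nonneg fun _ => by positivity]
  exact ⟨fun i => (key (χ i)).summable, by simpa only [(key _).tsum_eq] using h⟩

namespace IsEnsemble

variable {ρ σ : Op E} {ψ : I → E} {φ : J → E}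

theorem hasSum_inner (h : IsEnsemble ρ ψ) (x y : E) :
    HasSum (fun i => ⟪x, ψ i⟫_ℂ * ⟪ψ i, y⟫_ℂ) ⟪x, ρ y⟫_ℂ := by
  have := (h.hasSum.mapL (ContinuousLinearMap.apply ℂ E y)).mapL (innerSL ℂ x)
  simpa [inner_smul_right, mul_comm] using this

theorem hasSum_inner_self (h : IsEnsemble ρ ψ) (x : E) :
    HasSum (fun i => ‖⟪ψ i, x⟫_ℂ‖ ^ 2) (⟪x, ρ x⟫_ℂ).re := by
  have := (h.hasSum_inner x x).mapL Complex.reCLM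
  simp only [Complex.reCLM_apply] at this
  convert this using 1
  ext i
  rw [← inner_conj_symm x (ψ i), RCLike.conj_mul]
  simp [← Complex.ofReal_pow]

theorem isPositive (h : IsEnsemble ρ ψ) : ρ.IsPositive := by
  have h1 : ∀ x, 0 ≤ ⟪x, ρ x⟫_ℂ := fun x =>
    (h.hasSum_inner x x).nonneg fun i => by
      rw [← inner_conj_symm x (ψ i), RCLike.conj_mul]
      positivity
  rw [isPositive_iff_complex]
  intro x
  have h2 := Complex.nonneg_iff.1 (h1 x)
  rw [← inner_conj_symm (𝕜 := ℂ) (ρ x) x]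
  refine ⟨Complex.ext ?_ ?_, ?_⟩ <;> simp only [Complex.conj_re, Complex.conj_im, Complex.ofReal_im,
    Complex.ofReal_re, RCLike.re_to_complex, ← h2.2, neg_zero, h2.1]

variable [CompleteSpace E]

/-- Fubini on `I × basis`: summing over the basis first gives `⟪ψᵢ, A ψᵢ⟫` by Parseval, summing over
the ensemble first gives the trace in the fixed basis. -/
theorem hasSum_trace_comp (h : IsEnsemble ρ ψ) (A : Op E) :
    HasSum (fun i => ⟪ψ i, A (ψ i)⟫_ℂ) (trace (ρ ∘L A)) ∧
      Summable fun b => ⟪onb E b, ρ (A (onb E b))⟫_ℂ := by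
  have hA : Summable fun i => ‖adjoint A (ψ i)‖ ^ 2 :=
    Summable.of_nonneg_of_le (fun _ => by positivity)
      (fun i => by
        rw [← mul_pow]
        exact pow_le_pow_left₀ (norm_nonneg _) (le_opNorm _ _) 2)
      (h.summable.mul_left (‖adjoint A‖ ^ 2))
  have hF : Summable fun x : I × basisIndex E =>
      ⟪onb E x.2, ψ x.1⟫_ℂ * ⟪ψ x.1, A (onb E x.2)⟫_ℂ := by
    -- Domination by `|ab| ≤ a² + b²`, both squares being summable by Parseval.
    refine Summable.of_norm_bounded
      ((summable_norm_inner_sq (onb E) h.summable).add (summable_norm_inner_sq (onb E) hA)) ?_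
    intro x
    rw [norm_mul, ← adjoint_inner_left, norm_inner_symm]
    nlinarith [sq_nonneg (‖⟪ψ x.1, onb E x.2⟫_ℂ‖ - ‖⟪adjoint A (ψ x.1), onb E x.2⟫_ℂ‖),
      norm_nonneg ⟪ψ x.1, onb E x.2⟫_ℂ, norm_nonneg ⟪adjoint A (ψ x.1), onb E x.2⟫_ℂ]
  have h1 := hF.hasSum.prod_fiberwise (g := fun i => ⟪ψ i, A (ψ i)⟫_ℂ) fun i => by
    have := (onb E).hasSum_inner_mul_inner (adjoint A (ψ i)) (ψ i)
    simpa only [adjoint_inner_left, mul_comm] using this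
  have h2 : HasSum (fun x : basisIndex E × I =>
      ⟪onb E x.1, ψ x.2⟫_ℂ * ⟪ψ x.2, A (onb E x.1)⟫_ℂ) _ :=
    (Equiv.prodComm _ _).hasSum_iff.2 hF.hasSum
  have h3 := h2.prod_fiberwise (g := fun b => ⟪onb E b, ρ (A (onb E b))⟫_ℂ) fun b =>
    h.hasSum_inner (onb E b) (A (onb E b))
  refine ⟨?_, h3.summable⟩
  simp only [trace, coe_comp, Function.comp_apply]
  rwa [h3.tsum_eq]

theorem hasSum_trace (h : IsEnsemble ρ ψ) : HasSum (fun i => ‖ψ i‖ ^ 2) (trace ρ).re := by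
  have := ((h.hasSum_trace_comp 1).1).mapL Complex.reCLM
  simpa [inner_self_eq_norm_sq_to_K, ← Complex.ofReal_pow, one_def] using this

theorem trace_im (h : IsEnsemble ρ ψ) : (trace ρ).im = 0 := by
  have := ((h.hasSum_trace_comp 1).1).mapL Complex.imCLM
  simp only [one_apply_eq_self, inner_self_eq_norm_sq_to_K, Complex.imCLM_apply] at this
  have h2 : HasSum (fun i : I => (0 : ℝ)) (trace ρ).im := by
    simpa [← Complex.ofReal_pow, one_def] using this
  exact h2.unique hasSum_zero

theorem trace_nonneg (h : IsEnsemble ρ ψ) : 0 ≤ (trace ρ).re :=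
  h.hasSum_trace.nonneg fun _ => by positivity

theorem mem_partialDensity (h : IsEnsemble ρ ψ) (h1 : (trace ρ).re ≤ 1) :
    ρ ∈ PartialDensity E :=
  ⟨h.isPositive, by simpa using (h.hasSum_trace_comp 1).2, h1⟩

theorem sandwich (h : IsEnsemble ρ ψ) (A : E →L[ℂ] F) :
    IsEnsemble (sandwich A ρ) fun i => A (ψ i) where
  summable := Summable.of_nonneg_of_le (fun _ => by positivity)
      (fun i => by
        rw [← mul_pow]
        exact pow_le_pow_left₀ (norm_nonneg _) (le_opNorm _ _) 2)
      (h.summable.mul_left (‖A‖ ^ 2))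
  hasSum := by
    have := (h.hasSum.mapL ((compL ℂ F E E).flip (adjoint A))).mapL (compL ℂ F E F A)
    simpa [QTLogic.sandwich, rankOne_comp, comp_rankOne] using this

theorem add (h : IsEnsemble ρ ψ) (h' : IsEnsemble σ φ) :
    IsEnsemble (ρ + σ) (Sum.elim ψ φ) where
  summable := (HasSum.sum (f := fun x => ‖Sum.elim ψ φ x‖ ^ 2)
    h.summable.hasSum h'.summable.hasSum).summable
  hasSum := HasSum.sum (f := fun x => rankOne ℂ (Sum.elim ψ φ x) (Sum.elim ψ φ x))
    h.hasSum h'.hasSum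

theorem prod {K : Type*} {ρ : K → Op E} {ψ : K × I → E}
    (h : ∀ k, IsEnsemble (ρ k) fun i => ψ (k, i))
    (hs : Summable fun x => ‖ψ x‖ ^ 2) : IsEnsemble (∑' k, ρ k) ψ ∧ Summable ρ := by
  have h1 := (summable_rankOne hs).hasSum
  have h2 := h1.prod_fiberwise fun k => (h k).hasSum
  exact ⟨⟨hs, by rw [h2.tsum_eq]; exact h1⟩, h2.summable⟩

theorem sum {K : Type*} [Fintype K] {ρ : K → Op E} {ψ : K × I → E}
    (h : ∀ k, IsEnsemble (ρ k) fun i => ψ (k, i)) : IsEnsemble (∑ k, ρ k) ψ := by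
  rw [← tsum_fintype (L := .unconditional K)]
  refine (prod h ?_).1
  rw [summable_prod_of_nonneg fun _ => by positivity]
  exact ⟨fun k => (h k).summable, (hasSum_fintype _).summable⟩

theorem apply (h : IsEnsemble ρ ψ) (C : Channel E) :
    IsEnsemble (C.apply ρ) (fun x : ℕ × I => C.kraus x.1 (ψ x.2)) ∧
      Summable fun k => QTLogic.sandwich (C.kraus k) ρ := by
  refine prod (fun k => h.sandwich (C.kraus k)) ?_
  rw [← (Equiv.prodComm _ _).summable_iff, summable_prod_of_nonneg fun _ => by
    simp only [Pi.zero_apply, Function.comp]; positivity]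
  exact ⟨fun i => (C.tracePreserving (ψ i)).summable,
    by simpa [(C.tracePreserving _).tsum_eq] using h.summable⟩

/-- Since `⟪x, ρ x⟫ = ∑ |⟪ψᵢ, x⟫|²`, the null vectors of `ρ` are exactly those orthogonal to all
`ψᵢ`, so the support is the closed span of the ensemble. Both directions use `pᗮᗮ = p`-style
duality. -/
theorem sat_iff (h : IsEnsemble ρ ψ) {p : ClosedSubmodule ℂ E} : Sat ρ p ↔ ∀ i, ψ i ∈ p := by
  have hker : ∀ x, ⟪x, ρ x⟫_ℂ = 0 ↔ ∀ i, ⟪ψ i, x⟫_ℂ = 0 := by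
    intro x
    constructor
    · intro hx i
      have h1 := h.hasSum_inner_self x
      rw [hx, Complex.zero_re, hasSum_zero_iff_of_nonneg fun _ => by positivity] at h1
      simpa using congrFun h1 i
    · intro hx
      refine (h.hasSum_inner x x).unique ?_
      simp [hx]
  have : CompleteSpace p.toSubmodule := p.isClosed.completeSpace_coe
  constructor
  · intro hs i
    refine hs ?_
    change ψ i ∈ (Submodule.span ℂ {φ : E | ⟪φ, ρ φ⟫_ℂ = 0})ᗮ
    rw [Submodule.mem_orthogonal]
    intro u hu
    induction hu using Submodule.span_induction with
    | mem x hx => rw [← inner_conj_symm, (hker x).1 hx i, map_zero]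
    | zero => simp
    | add x y _ _ hx hy => rw [inner_add_left, hx, hy, add_zero]
    | smul a x _ hx => rw [inner_smul_left, hx, mul_zero]
  · intro hp x hx
    change x ∈ (Submodule.span ℂ {φ : E | ⟪φ, ρ φ⟫_ℂ = 0})ᗮ at hx
    rw [← ClosedSubmodule.mem_toSubmodule_iff, ← Submodule.orthogonal_orthogonal p.toSubmodule,
      Submodule.mem_orthogonal]
    intro u hu
    refine (Submodule.mem_orthogonal _ _).1 hx u (Submodule.subset_span ?_)
    exact (hker u).2 fun i => (Submodule.mem_orthogonal _ _).1 hu _ (hp i)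

end IsEnsemble

variable [CompleteSpace E]

variable (ρ : Op E) in
/-- Positive trace class operators, described by ensembles. -/
def IsTraceClass : Prop := ∃ ψ : basisIndex E → E, IsEnsemble ρ ψ

/-- The ensemble is `√ρ e_b` over the fixed orthonormal basis; Parseval recovers `ρ = √ρ √ρ`. -/
theorem isTraceClass_of_summable {ρ : Op E} (hpos : ρ.IsPositive)
    (hsum : Summable fun b => ⟪onb E b, ρ (onb E b)⟫_ℂ) : IsTraceClass ρ := by
  have h0 : 0 ≤ ρ := (nonneg_iff_isPositive ρ).2 hpos
  obtain ⟨B, hB, hBB⟩ : ∃ B : Op E, IsSelfAdjoint B ∧ B * B = ρ :=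
    ⟨CFC.sqrt ρ, IsSelfAdjoint.of_nonneg (CFC.sqrt_nonneg ρ), CFC.sqrt_mul_sqrt_self ρ h0⟩
  have hin : ∀ x y, ⟪x, ρ y⟫_ℂ = ⟪B x, B y⟫_ℂ := fun x y => by
    rw [← hBB, mul_apply_eq_comp, ← adjoint_inner_left, ← star_eq_adjoint, hB.star_eq]
  have hsw : ∀ x y, ⟪B x, y⟫_ℂ = ⟪x, B y⟫_ℂ := fun x y => by
    rw [← adjoint_inner_right, ← star_eq_adjoint, hB.star_eq]
  have hs : Summable fun b => ‖B (onb E b)‖ ^ 2 := by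
    have := hsum.mapL Complex.reCLM
    simpa [hin, inner_self_eq_norm_sq_to_K, ← Complex.ofReal_pow] using this
  refine ⟨fun b => B (onb E b), hs, ?_⟩
  have hS : IsEnsemble _ fun b => B (onb E b) := ⟨hs, (summable_rankOne hs).hasSum⟩
  convert hS.hasSum using 1
  ext y
  refine ext_inner_left ℂ fun x => ?_
  refine HasSum.unique ?_ (hS.hasSum_inner x y)
  rw [hin]
  simpa only [hsw] using (onb E).hasSum_inner_mul_inner (B x) (B y)

theorem IsEnsemble.isTraceClass {ρ : Op E} {ψ : I → E} (h : IsEnsemble ρ ψ) : IsTraceClass ρ :=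
  isTraceClass_of_summable h.isPositive (by simpa using (h.hasSum_trace_comp 1).2)

theorem isTraceClass_of_mem {ρ : Op E} (h : ρ ∈ PartialDensity E) : IsTraceClass ρ :=
  isTraceClass_of_summable h.1 h.2.1

namespace IsTraceClass

variable {ρ σ : Op E}

theorem mem_partialDensity (h : IsTraceClass ρ) (h1 : (trace ρ).re ≤ 1) : ρ ∈ PartialDensity E :=
  let ⟨_, hψ⟩ := h
  hψ.mem_partialDensity h1

theorem trace_nonneg (h : IsTraceClass ρ) : 0 ≤ (trace ρ).re :=
  let ⟨_, hψ⟩ := h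
  hψ.trace_nonneg

theorem trace_im (h : IsTraceClass ρ) : (trace ρ).im = 0 :=
  let ⟨_, hψ⟩ := h
  hψ.trace_im

theorem zero : IsTraceClass (0 : Op E) :=
  isTraceClass_of_summable isPositive_zero (by simp)

theorem add (hρ : IsTraceClass ρ) (hσ : IsTraceClass σ) : IsTraceClass (ρ + σ) :=
  let ⟨_, hψ⟩ := hρ
  let ⟨_, hφ⟩ := hσ
  (hψ.add hφ).isTraceClass

theorem sandwich (h : IsTraceClass ρ) (A : E →L[ℂ] F) : IsTraceClass (sandwich A ρ) :=
  let ⟨_, hψ⟩ := h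
  (hψ.sandwich A).isTraceClass

theorem trace_comp_add (hρ : IsTraceClass ρ) (hσ : IsTraceClass σ) (A : Op E) :
    trace ((ρ + σ) ∘L A) = trace (ρ ∘L A) + trace (σ ∘L A) := by
  obtain ⟨_, hψ⟩ := hρ
  obtain ⟨_, hφ⟩ := hσ
  simpa [trace] using (hψ.hasSum_trace_comp A).2.tsum_add (hφ.hasSum_trace_comp A).2

theorem sat_add_iff (hρ : IsTraceClass ρ) (hσ : IsTraceClass σ) {p : ClosedSubmodule ℂ E} :
    Sat (ρ + σ) p ↔ Sat ρ p ∧ Sat σ p := by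
  obtain ⟨_, hψ⟩ := hρ
  obtain ⟨_, hφ⟩ := hσ
  rw [(hψ.add hφ).sat_iff, hψ.sat_iff, hφ.sat_iff, Sum.forall]
  rfl

theorem sat_sandwich_iff (h : IsTraceClass ρ) {A : E →L[ℂ] F} {p : ClosedSubmodule ℂ F} :
    Sat (QTLogic.sandwich A ρ) p ↔ Sat ρ (p.comap A) := by
  obtain ⟨_, hψ⟩ := h
  rw [(hψ.sandwich A).sat_iff, hψ.sat_iff]
  rfl

theorem trace_sandwich_le (h : IsTraceClass ρ) {A : E →L[ℂ] F} (hA : ∀ x, ‖A x‖ ≤ ‖x‖) :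
    (trace (QTLogic.sandwich A ρ)).re ≤ (trace ρ).re := by
  obtain ⟨_, hψ⟩ := h
  exact hasSum_le (fun i => pow_le_pow_left₀ (norm_nonneg _) (hA _) 2)
    (hψ.sandwich A).hasSum_trace hψ.hasSum_trace

theorem sum {K : Type*} {s : Finset K} {ρ : K → Op E} (h : ∀ k, IsTraceClass (ρ k)) :
    IsTraceClass (∑ k ∈ s, ρ k) :=
  Finset.sum_induction _ _ (fun _ _ => add) zero fun k _ => h k

theorem sat_zero (p : ClosedSubmodule ℂ E) : Sat (0 : Op E) p := by
  have h : IsEnsemble (0 : Op E) fun _ : Empty => 0 := ⟨summable_empty, by simp⟩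
  exact h.sat_iff.2 fun i => i.elim

theorem sat_sum_iff {K : Type*} {s : Finset K} {ρ : K → Op E} (h : ∀ k, IsTraceClass (ρ k))
    {p : ClosedSubmodule ℂ E} : Sat (∑ k ∈ s, ρ k) p ↔ ∀ k ∈ s, Sat (ρ k) p := by
  classical
  induction s using Finset.induction_on with
  | empty => simp [sat_zero]
  | insert a s ha ih =>
    rw [Finset.sum_insert ha, (h a).sat_add_iff (sum h), ih, Finset.forall_mem_insert]

theorem trace_comp_sum {K : Type*} {s : Finset K} {ρ : K → Op E} (h : ∀ k, IsTraceClass (ρ k))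
    (A : Op E) : trace ((∑ k ∈ s, ρ k) ∘L A) = ∑ k ∈ s, trace (ρ k ∘L A) := by
  classical
  induction s using Finset.induction_on with
  | empty => simp [trace]
  | insert a s ha ih =>
    rw [Finset.sum_insert ha, Finset.sum_insert ha, (h a).trace_comp_add (sum h), ih]

theorem trace_sum {K : Type*} {s : Finset K} {ρ : K → Op E} (h : ∀ k, IsTraceClass (ρ k)) :
    trace (∑ k ∈ s, ρ k) = ∑ k ∈ s, trace (ρ k) := by
  simpa [one_def] using trace_comp_sum (s := s) h 1

/-- Summable traces make the union of the ensembles an ensemble for the infinite sum, so trace and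
satisfaction are read off piece by piece. -/
theorem tsum {ρ : ℕ → Op E} (h : ∀ n, IsTraceClass (ρ n))
    (hs : Summable fun n => (trace (ρ n)).re) :
    IsTraceClass (∑' n, ρ n) ∧ HasSum (fun n => (trace (ρ n)).re) (trace (∑' n, ρ n)).re ∧
      ∀ p, Sat (∑' n, ρ n) p ↔ ∀ n, Sat (ρ n) p := by
  choose ψ hψ using h
  have h1 : Summable fun x : ℕ × basisIndex E => ‖ψ x.1 x.2‖ ^ 2 := by
    rw [summable_prod_of_nonneg fun _ => by positivity]
    exact ⟨fun n => (hψ n).summable, by simpa [(hψ _).hasSum_trace.tsum_eq] using hs⟩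
  have h2 := (IsEnsemble.prod (ψ := fun x : ℕ × basisIndex E => ψ x.1 x.2) hψ h1).1
  refine ⟨h2.isTraceClass, h2.hasSum_trace.prod_fiberwise fun n => (hψ n).hasSum_trace,
    fun p => ?_⟩
  rw [h2.sat_iff]
  simp only [(hψ _).sat_iff, Prod.forall]

/-- Trace class matters here: it makes the Kraus series converge, whereas a divergent `tsum` takes
the default value `0`. -/
theorem apply_add (hρ : IsTraceClass ρ) (hσ : IsTraceClass σ) (C : Channel E) :
    C.apply (ρ + σ) = C.apply ρ + C.apply σ := by
  obtain ⟨_, hψ⟩ := hρ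
  obtain ⟨_, hφ⟩ := hσ
  rw [Channel.apply, Channel.apply, Channel.apply, ← (hψ.apply C).2.tsum_add (hφ.apply C).2]
  simp [QTLogic.sandwich, comp_add]

end IsTraceClass

theorem sandwich_sandwich {G : Type*} [NormedAddCommGroup G] [InnerProductSpace ℂ G]
    [CompleteSpace G] (A : F →L[ℂ] G) (B : E →L[ℂ] F) (ρ : Op E) :
    sandwich A (sandwich B ρ) = sandwich (A ∘L B) ρ := by
  simp [sandwich, adjoint_comp, comp_assoc]

theorem inner_proj_self (p : ClosedSubmodule ℂ E) (x : E) :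
    ⟪x, proj p x⟫_ℂ = (‖proj p x‖ ^ 2 : ℝ) := by
  have : CompleteSpace p.toSubmodule := p.isClosed.completeSpace_coe
  change ⟪x, p.toSubmodule.starProjection x⟫_ℂ = (‖p.toSubmodule.starProjection x‖ ^ 2 : ℝ)
  have h := Submodule.starProjection_eq_self_iff.2
    (Submodule.starProjection_apply_mem p.toSubmodule x)
  calc _ = ⟪x, p.toSubmodule.starProjection (p.toSubmodule.starProjection x)⟫_ℂ := by rw [h]
    _ = _ := by
      rw [← Submodule.inner_starProjection_left_eq_right]
      simp [inner_self_eq_norm_sq_to_K]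

theorem norm_proj_le (p : ClosedSubmodule ℂ E) (x : E) : ‖proj p x‖ ≤ ‖x‖ := by
  have : CompleteSpace p.toSubmodule := p.isClosed.completeSpace_coe
  exact p.toSubmodule.norm_starProjection_apply_le x

theorem norm_proj_eq_iff {p : ClosedSubmodule ℂ E} {x : E} : ‖proj p x‖ = ‖x‖ ↔ x ∈ p := by
  have : CompleteSpace p.toSubmodule := p.isClosed.completeSpace_coe
  exact (p.toSubmodule.mem_iff_norm_starProjection x).symm

theorem proj_eq_zero_iff {p : ClosedSubmodule ℂ E} {x : E} :
    proj p x = 0 ↔ x ∈ p.toSubmoduleᗮ := by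
  have : CompleteSpace p.toSubmodule := p.isClosed.completeSpace_coe
  exact Submodule.starProjection_apply_eq_zero_iff p.toSubmodule

/-- The quadratic form is `‖proj a x‖² + ‖proj b x‖²`, which vanishes only if both terms do; thus
the null vectors are `aᗮ ∩ bᗮ`. -/
theorem supp_proj_add_proj (a b : ClosedSubmodule ℂ E) : supp (proj a + proj b) = a ⊔ b := by
  have hker : ∀ x, ⟪x, (proj a + proj b) x⟫_ℂ = 0 ↔ x ∈ a.toSubmoduleᗮ ∧ x ∈ b.toSubmoduleᗮ := by
    intro x
    rw [← proj_eq_zero_iff, ← proj_eq_zero_iff, add_apply, inner_add_right, inner_proj_self,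
      inner_proj_self, ← Complex.ofReal_add, Complex.ofReal_eq_zero,
      add_eq_zero_iff_of_nonneg (by positivity) (by positivity)]
    simp
  apply le_antisymm
  · intro x hx
    change x ∈ (Submodule.span ℂ {φ : E | ⟪φ, (proj a + proj b) φ⟫_ℂ = 0})ᗮ at hx
    have : CompleteSpace (a ⊔ b).toSubmodule := (a ⊔ b).isClosed.completeSpace_coe
    rw [← ClosedSubmodule.mem_toSubmodule_iff, ← Submodule.orthogonal_orthogonal
      (a ⊔ b).toSubmodule, Submodule.mem_orthogonal]
    intro u hu
    refine (Submodule.mem_orthogonal _ _).1 hx u (Submodule.subset_span ?_)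
    have ha : a.toSubmodule ≤ (a ⊔ b).toSubmodule := (le_sup_left : a ≤ a ⊔ b)
    have hb : b.toSubmodule ≤ (a ⊔ b).toSubmodule := (le_sup_right : b ≤ a ⊔ b)
    exact (hker u).2 ⟨Submodule.orthogonal_le ha hu, Submodule.orthogonal_le hb hu⟩
  · have h : ∀ x, (∀ u, ⟪u, (proj a + proj b) u⟫_ℂ = 0 → ⟪u, x⟫_ℂ = 0) →
        x ∈ supp (proj a + proj b) := by
      intro x hx
      change x ∈ (Submodule.span ℂ {φ : E | ⟪φ, (proj a + proj b) φ⟫_ℂ = 0})ᗮ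
      rw [Submodule.mem_orthogonal]
      intro u hu
      induction hu using Submodule.span_induction with
      | mem u hu => exact hx u hu
      | zero => simp
      | add x y _ _ hx hy => rw [inner_add_left, hx, hy, add_zero]
      | smul a x _ hx => rw [inner_smul_left, hx, mul_zero]
    exact sup_le
      (fun x hx => h x fun u hu => (Submodule.mem_orthogonal' _ _).1 ((hker u).1 hu).1 x hx)
      fun x hx => h x fun u hu => (Submodule.mem_orthogonal' _ _).1 ((hker u).1 hu).2 x hx

namespace IsTraceClass

variable {ρ : Op E} {p : ClosedSubmodule ℂ E}

theorem trace_comp_proj_eq (h : IsTraceClass ρ) (p : ClosedSubmodule ℂ E) :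
    (trace (ρ ∘L proj p)).re = (trace (QTLogic.sandwich (proj p) ρ)).re := by
  obtain ⟨ψ, hψ⟩ := h
  have h1 := (hψ.hasSum_trace_comp (proj p)).1.mapL Complex.reCLM
  simp only [inner_proj_self, Complex.reCLM_apply, Complex.ofReal_re] at h1
  exact h1.unique (hψ.sandwich (proj p)).hasSum_trace

theorem trace_comp_proj_nonneg (h : IsTraceClass ρ) (p : ClosedSubmodule ℂ E) :
    0 ≤ (trace (ρ ∘L proj p)).re := by
  rw [h.trace_comp_proj_eq]
  exact (h.sandwich _).trace_nonneg

theorem trace_comp_proj_le (h : IsTraceClass ρ) (p : ClosedSubmodule ℂ E) :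
    (trace (ρ ∘L proj p)).re ≤ (trace ρ).re := by
  rw [h.trace_comp_proj_eq]
  exact h.trace_sandwich_le (norm_proj_le p)

/-- Termwise `‖proj p ψᵢ‖ ≤ ‖ψᵢ‖` with equality only for `ψᵢ ∈ p`, so a single vector outside `p`
makes the sum strictly smaller. -/
theorem trace_comp_proj_eq_iff (h : IsTraceClass ρ) :
    (trace (ρ ∘L proj p)).re = (trace ρ).re ↔ Sat ρ p := by
  rw [h.trace_comp_proj_eq]
  obtain ⟨ψ, hψ⟩ := h
  have h1 := (hψ.sandwich (proj p)).hasSum_trace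
  have h2 := hψ.hasSum_trace
  have hle : ∀ i, ‖proj p (ψ i)‖ ^ 2 ≤ ‖ψ i‖ ^ 2 := fun i =>
    pow_le_pow_left₀ (norm_nonneg _) (norm_proj_le p _) 2
  rw [hψ.sat_iff]
  constructor
  · intro he i
    by_contra hi
    refine (hasSum_lt hle (i := i) ?_ h1 h2).ne he
    exact pow_lt_pow_left₀ (lt_of_le_of_ne (norm_proj_le p _) (mt norm_proj_eq_iff.1 hi))
      (norm_nonneg _) two_ne_zero
  · intro hp
    exact h1.unique (by simpa only [norm_proj_eq_iff.2 (hp _)] using h2)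

end IsTraceClass

/-- Pure states suffice as tests: normalise a vector of `P` and use its rank-one projection. -/
theorem forall_sat_iff_le {P R : ClosedSubmodule ℂ E} :
    (∀ ρ ∈ PartialDensity E, Sat ρ P → Sat ρ R) ↔ P ≤ R := by
  refine ⟨fun h x hx => ?_, fun h ρ _ hs => le_trans hs h⟩
  rcases eq_or_ne x 0 with rfl | hx0
  · exact R.toSubmodule.zero_mem
  have hu : ‖((‖x‖ : ℂ)⁻¹) • x‖ = 1 := by
    rw [norm_smul]
    simp [hx0]
  set u := ((‖x‖ : ℂ)⁻¹) • x with hudef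
  have hens := isEnsemble_rankOne u
  have htr : (trace (rankOne ℂ u u)).re = 1 := by
    have := hens.hasSum_trace
    exact this.unique (by simp [hu])
  have := h _ (hens.mem_partialDensity htr.le)
    (hens.sat_iff.2 fun _ => P.toSubmodule.smul_mem _ hx)
  have hmem := R.toSubmodule.smul_mem (‖x‖ : ℂ) (hens.sat_iff.1 this ())
  rwa [hudef, smul_smul, mul_inv_cancel₀ (by simpa using hx0), one_smul] at hmem

end Ensembles

end QTLogic

end

noncomputable section

namespace QTLogic

open InnerProductSpace ContinuousLinearMap

/-! ### Denotational semantics of a loop with atomic body. -/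

section Denotation

variable {E : Type*} [NormedAddCommGroup E] [InnerProductSpace ℂ E] [CompleteSpace E]

theorem denote_apply (𝓔 : Op E → Op E) (ρ : Op E) : denote (.apply 𝓔) ρ = 𝓔 ρ := by
  have h2 : ∀ n, reached (some (.apply 𝓔), ρ) (n + 2) = 0 := by
    intro n
    induction n with
    | zero => simp [reached, successors, transitions]
    | succ n ih => rw [reached, ih]; rfl
  rw [denote, tsum_eq_single 1]
  · simp [outputs, reached, successors, transitions, Multiset.filter_singleton]
  · rintro (_ | _ | n) hn
    · simp [outputs, reached, Multiset.filter_singleton]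
    · exact absurd rfl hn
    · rw [outputs, h2]; simp

/-- Each round takes two transitions (guard, then atomic body), so the `n`-th output appears at time
`2n + 1` and nothing terminates at even times. -/
theorem denote_loop (M₀ M₁ : Op E) (𝓔 : Op E → Op E) (ρ : Op E) :
    denote (.loop M₀ M₁ (.apply 𝓔)) ρ =
      ∑' n : ℕ, sandwich M₀ ((fun σ => 𝓔 (sandwich M₁ σ))^[n] ρ) := by
  set G : Op E → Op E := fun σ => 𝓔 (sandwich M₁ σ) with hG
  set S : QWhile E := .loop M₀ M₁ (.apply 𝓔) with hS
  have heven : ∀ n, reached (some S, ρ) (2 * n) = {(some S, G^[n] ρ)} := by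
    intro n
    induction n with
    | zero => simp [reached]
    | succ n ih =>
      rw [show 2 * (n + 1) = 2 * n + 1 + 1 by ring, reached, reached, ih,
        Function.iterate_succ_apply']
      simp [successors, transitions, hS, hG, seqOpt]
  have hodd : ∀ n, reached (some S, ρ) (2 * n + 1) =
      {(none, sandwich M₀ (G^[n] ρ)),
        (some (.seq (.apply 𝓔) S), sandwich M₁ (G^[n] ρ))} := by
    intro n
    rw [reached, heven]
    simp [successors, transitions, hS]
  have hout : ∀ n, (outputs S ρ (2 * n + 1)).sum = sandwich M₀ (G^[n] ρ) := by
    intro n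
    rw [outputs, hodd]
    simp [Multiset.insert_eq_cons, Multiset.filter_singleton]
  have hinj : Function.Injective fun n : ℕ => 2 * n + 1 := fun a b h => by simpa using h
  rw [denote, ← hinj.tsum_eq]
  · simp only [hout]
  · intro m hm
    by_contra hm'
    obtain ⟨k, rfl⟩ : Even m := by
      rw [← Nat.not_odd_iff_even]
      rintro ⟨k, rfl⟩
      exact hm' ⟨k, rfl⟩
    refine hm ?_
    simp [outputs, ← two_mul, heven, Multiset.filter_singleton]

end Denotation

/-! ### Block-diagonal subspaces of the joint space. -/

section Blocks

variable {H : Type*} [NormedAddCommGroup H] [InnerProductSpace ℂ H] {L : Type*}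

theorem joint_ext {ψ φ : Joint H L} (h : ∀ l, bra l ψ = bra l φ) : ψ = φ :=
  PiLp.ext h

theorem mem_block {P : L → ClosedSubmodule ℂ H} {ψ : Joint H L} :
    ψ ∈ block P ↔ ∀ l, bra l ψ ∈ P l := by
  simp [block]

variable [Fintype L]

theorem norm_sq_eq_sum_bra (ψ : Joint H L) : ‖ψ‖ ^ 2 = ∑ l, ‖bra l ψ‖ ^ 2 :=
  PiLp.norm_sq_eq_of_L2 _ _

theorem norm_bra_le (l : L) (ψ : Joint H L) : ‖bra l ψ‖ ≤ ‖ψ‖ :=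
  PiLp.norm_apply_le ψ l

variable [CompleteSpace H]

theorem ketbra_eq_sandwich (A : Op H) (l : L) : ketbra A l l = sandwich (adjoint (bra l)) A := by
  rw [ketbra, sandwich, adjoint_adjoint]

variable [DecidableEq L]

theorem adjoint_bra_apply (l : L) (x : H) :
    adjoint (bra l) x = (WithLp.toLp 2 (Pi.single l x) : Joint H L) := by
  refine ext_inner_right ℂ fun v => ?_
  rw [adjoint_inner_left, PiLp.inner_apply, Finset.sum_eq_single l]
  · simp [bra]
  · intro k _ hk
    simp [hk]
  · simp

theorem bra_adjoint_bra (k l : L) (x : H) :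
    bra k (adjoint (bra l) x) = if k = l then x else 0 := by
  rw [adjoint_bra_apply]
  simp [bra]

theorem bra_ketbra (A : Op H) (m k l : L) (ψ : Joint H L) :
    bra m (ketbra A k l ψ) = if m = k then A (bra l ψ) else 0 :=
  bra_adjoint_bra _ _ _

theorem sum_ketbra_one (ψ : Joint H L) : ∑ l, ketbra 1 l l ψ = ψ :=
  joint_ext fun k => by simp [map_sum, bra_ketbra]

theorem norm_adjoint_bra (l : L) (x : H) : ‖adjoint (bra l) x‖ = ‖x‖ := by
  rw [← sq_eq_sq₀ (norm_nonneg _) (norm_nonneg _), norm_sq_eq_sum_bra]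
  simp [bra_adjoint_bra, apply_ite]

/-- A closed subspace is block-diagonal precisely when it is stable under the location projections;
the blocks are recovered as preimages under the embeddings `adjoint (bra l)`. -/
theorem mem_AP_iff {p : ClosedSubmodule ℂ (Joint H L)} :
    p ∈ AP H L ↔ ∀ ψ ∈ p, ∀ l, ketbra 1 l l ψ ∈ p := by
  constructor
  · rintro ⟨P, rfl⟩ ψ hψ l
    rw [mem_block] at hψ ⊢
    intro k
    rw [bra_ketbra]
    split_ifs with h
    · exact h ▸ hψ k
    · exact (P k).toSubmodule.zero_mem
  · intro h
    refine ⟨fun l => p.comap (adjoint (bra l)), le_antisymm (fun ψ hψ => ?_) fun ψ hψ => ?_⟩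
    · rw [mem_block] at hψ
      rw [← sum_ketbra_one ψ]
      exact p.toSubmodule.sum_mem fun l _ => hψ l
    · exact mem_block.2 (h ψ hψ)

theorem inf_mem_AP {p q : ClosedSubmodule ℂ (Joint H L)} (hp : p ∈ AP H L) (hq : q ∈ AP H L) :
    p ⊓ q ∈ AP H L :=
  mem_AP_iff.2 fun ψ hψ l => ⟨mem_AP_iff.1 hp ψ hψ.1 l, mem_AP_iff.1 hq ψ hψ.2 l⟩

theorem iInf_mem_AP {ι : Sort*} {p : ι → ClosedSubmodule ℂ (Joint H L)} (hp : ∀ i, p i ∈ AP H L) :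
    ⨅ i, p i ∈ AP H L := by
  refine mem_AP_iff.2 fun ψ hψ l => ?_
  rw [ClosedSubmodule.mem_iInf] at hψ ⊢
  exact fun i => mem_AP_iff.1 (hp i) ψ (hψ i) l

theorem comap_mem_AP {p : ClosedSubmodule ℂ (Joint H L)} {A : Op (Joint H L)}
    (h : ∀ ψ l, A ψ ∈ p → A (ketbra 1 l l ψ) ∈ p) : p.comap A ∈ AP H L :=
  mem_AP_iff.2 fun ψ hψ l => h ψ l hψ

end Blocks

/-! ### Guard projections and the invariant subspace of the rules. -/

namespace ExitProgram

variable {H : Type*} [NormedAddCommGroup H] [InnerProductSpace ℂ H] [CompleteSpace H]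
variable {L : Type*} [Fintype L] [DecidableEq L]
variable (π : ExitProgram H L) {p q : ClosedSubmodule ℂ (Joint H L)}

theorem bra_M₀ (l : L) (ψ : Joint H L) :
    bra l (π.M₀ ψ) = if l = π.exit then bra l ψ else 0 := by
  rw [M₀, bra_ketbra]
  split_ifs with h
  · rw [h]; rfl
  · rfl

theorem bra_M₁ (l : L) (ψ : Joint H L) :
    bra l (π.M₁ ψ) = if l = π.exit then 0 else bra l ψ := by
  simp only [M₁, sum_apply, map_sum, bra_ketbra, one_apply_eq_self]
  split_ifs with h
  · exact Finset.sum_eq_zero fun k hk => if_neg fun (e : l = k) =>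
      Finset.ne_of_mem_erase hk (e ▸ h)
  · rw [Finset.sum_ite_eq, if_pos (by simpa using h)]

theorem M₀_add_M₁ (ψ : Joint H L) : π.M₀ ψ + π.M₁ ψ = ψ :=
  joint_ext fun l => by rw [map_add, bra_M₀, bra_M₁]; split_ifs <;> simp

theorem M₀_ketbra (l : L) (ψ : Joint H L) :
    π.M₀ (ketbra 1 l l ψ) = ketbra 1 l l (π.M₀ ψ) :=
  joint_ext fun k => by
    simp only [bra_M₀, bra_ketbra, one_apply_eq_self]; grind

theorem M₁_ketbra (l : L) (ψ : Joint H L) :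
    π.M₁ (ketbra 1 l l ψ) = ketbra 1 l l (π.M₁ ψ) :=
  joint_ext fun k => by
    simp only [bra_M₁, bra_ketbra, one_apply_eq_self]; grind

theorem norm_sq_M₀_add_norm_sq_M₁ (ψ : Joint H L) : ‖π.M₀ ψ‖ ^ 2 + ‖π.M₁ ψ‖ ^ 2 = ‖ψ‖ ^ 2 := by
  simp only [norm_sq_eq_sum_bra, ← Finset.sum_add_distrib]
  exact Finset.sum_congr rfl fun l _ => by rw [bra_M₀, bra_M₁]; split_ifs <;> simp

theorem norm_M₀_le (ψ : Joint H L) : ‖π.M₀ ψ‖ ≤ ‖ψ‖ := by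
  refine le_of_sq_le_sq ?_ (norm_nonneg _)
  nlinarith [π.norm_sq_M₀_add_norm_sq_M₁ ψ, sq_nonneg ‖π.M₁ ψ‖]

theorem norm_M₁_le (ψ : Joint H L) : ‖π.M₁ ψ‖ ≤ ‖ψ‖ := by
  refine le_of_sq_le_sq ?_ (norm_nonneg _)
  nlinarith [π.norm_sq_M₀_add_norm_sq_M₁ ψ, sq_nonneg ‖π.M₀ ψ‖]

theorem mem_exitSpace {ψ : Joint H L} : ψ ∈ π.exitSpace ↔ π.M₁ ψ = 0 := by
  rw [exitSpace, mem_block]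
  constructor
  · intro h
    refine joint_ext fun l => ?_
    have := h l
    rw [bra_M₁, map_zero]
    split_ifs with hl
    · rfl
    · simpa [hl] using this
  · intro h l
    split_ifs with hl
    · trivial
    · have := congrArg (bra l) h
      rwa [bra_M₁, if_neg hl, map_zero] at this

theorem mem_runSpace {ψ : Joint H L} : ψ ∈ π.runSpace ↔ π.M₀ ψ = 0 := by
  rw [runSpace, mem_block]
  constructor
  · intro h
    refine joint_ext fun l => ?_
    have := h l
    rw [bra_M₀, map_zero]
    split_ifs with hl
    · simpa [hl] using this
    · rfl
  · intro h l
    split_ifs with hl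
    · have := congrArg (bra l) h
      rwa [bra_M₀, if_pos hl, map_zero] at this
    · trivial

theorem M₀_mem_exitSpace (ψ : Joint H L) : π.M₀ ψ ∈ π.exitSpace :=
  π.mem_exitSpace.2 <| joint_ext fun l => by rw [bra_M₁, bra_M₀]; split_ifs <;> simp

theorem M₁_mem_runSpace (ψ : Joint H L) : π.M₁ ψ ∈ π.runSpace :=
  π.mem_runSpace.2 <| joint_ext fun l => by rw [bra_M₀, bra_M₁]; split_ifs <;> simp

theorem M₀_mem (hp : p ∈ AP H L) {ψ : Joint H L} (hψ : ψ ∈ p) : π.M₀ ψ ∈ p :=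
  mem_AP_iff.1 hp ψ hψ _

theorem M₁_mem (hp : p ∈ AP H L) {ψ : Joint H L} (hψ : ψ ∈ p) : π.M₁ ψ ∈ p := by
  rw [M₁, sum_apply]
  exact p.toSubmodule.sum_mem fun l _ => mem_AP_iff.1 hp ψ hψ l

theorem eq_M₀_of_mem_exitSpace {ψ : Joint H L} (h : ψ ∈ π.exitSpace) : π.M₀ ψ = ψ := by
  simpa [π.mem_exitSpace.1 h] using π.M₀_add_M₁ ψ

theorem eq_M₁_of_mem_runSpace {ψ : Joint H L} (h : ψ ∈ π.runSpace) : π.M₁ ψ = ψ := by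
  simpa [π.mem_runSpace.1 h] using π.M₀_add_M₁ ψ

theorem runSpace_sup_eq : π.runSpace ⊔ (π.exitSpace ⊓ q) = q.comap π.M₀ := by
  apply le_antisymm
  · refine sup_le (fun ψ hψ => ?_) fun ψ hψ => ?_
    · rw [ClosedSubmodule.mem_comap, π.mem_runSpace.1 hψ]
      exact q.toSubmodule.zero_mem
    · rw [ClosedSubmodule.mem_comap, π.eq_M₀_of_mem_exitSpace hψ.1]
      exact hψ.2
  · intro ψ hψ
    rw [← π.M₀_add_M₁ ψ]
    exact (π.runSpace ⊔ (π.exitSpace ⊓ q)).toSubmodule.add_mem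
      ((le_sup_right : _ ≤ π.runSpace ⊔ (π.exitSpace ⊓ q)) ⟨π.M₀_mem_exitSpace ψ, hψ⟩)
      ((le_sup_left : _ ≤ π.runSpace ⊔ (π.exitSpace ⊓ q)) (π.M₁_mem_runSpace ψ))

theorem comap_M₀_eq_of_runSpace_le (hq : q ∈ AP H L) (h : π.runSpace ≤ q) : q.comap π.M₀ = q := by
  refine le_antisymm (fun ψ hψ => ?_) fun ψ hψ => π.M₀_mem hq hψ
  rw [← π.M₀_add_M₁ ψ]
  exact q.toSubmodule.add_mem hψ (h (π.M₁_mem_runSpace ψ))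

/-- The support of the sum is the join of `M₀ ∧ q` and `M₁ ∧ p`; these lie in complementary
orthogonal ranges, so membership splits into independent conditions on the two components. No
commutation with `p` or `q` is needed. -/
theorem inv_eq : π.inv p q = q.comap π.M₀ ⊓ p.comap π.M₁ := by
  rw [inv, supp_proj_add_proj]
  apply le_antisymm
  · refine sup_le (fun ψ hψ => ⟨?_, ?_⟩) fun ψ hψ => ⟨?_, ?_⟩
    · change π.M₀ ψ ∈ q
      rw [π.eq_M₀_of_mem_exitSpace hψ.1]
      exact hψ.2
    · change π.M₁ ψ ∈ p
      rw [π.mem_exitSpace.1 hψ.1]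
      exact p.toSubmodule.zero_mem
    · change π.M₀ ψ ∈ q
      rw [π.mem_runSpace.1 hψ.1]
      exact q.toSubmodule.zero_mem
    · change π.M₁ ψ ∈ p
      rw [π.eq_M₁_of_mem_runSpace hψ.1]
      exact hψ.2
  · rintro ψ ⟨h0, h1⟩
    rw [← π.M₀_add_M₁ ψ]
    exact (π.exitSpace ⊓ q ⊔ π.runSpace ⊓ p).toSubmodule.add_mem
      ((le_sup_left : _ ≤ π.exitSpace ⊓ q ⊔ π.runSpace ⊓ p) ⟨π.M₀_mem_exitSpace ψ, h0⟩)
      ((le_sup_right : _ ≤ π.exitSpace ⊓ q ⊔ π.runSpace ⊓ p) ⟨π.M₁_mem_runSpace ψ, h1⟩)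

theorem comap_M₀_mem_AP (hq : q ∈ AP H L) : q.comap π.M₀ ∈ AP H L :=
  comap_mem_AP fun ψ l h => by rw [M₀_ketbra]; exact mem_AP_iff.1 hq _ h l

theorem comap_M₁_mem_AP (hp : p ∈ AP H L) : p.comap π.M₁ ∈ AP H L :=
  comap_mem_AP fun ψ l h => by rw [M₁_ketbra]; exact mem_AP_iff.1 hp _ h l

theorem inv_mem_AP (hp : p ∈ AP H L) (hq : q ∈ AP H L) : π.inv p q ∈ AP H L := by
  rw [inv_eq]
  exact inf_mem_AP (π.comap_M₀_mem_AP hq) (π.comap_M₁_mem_AP hp)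

end ExitProgram

end QTLogic

end

noncomputable section

namespace QTLogic

open InnerProductSpace ContinuousLinearMap Filter
open scoped Topology

/-! ### Kraus form of one step, and iteration of the loop. -/

theorem IsEnsemble.comp_equiv {E : Type*} [NormedAddCommGroup E] [InnerProductSpace ℂ E]
    {I J : Type*} {ρ : Op E} {ψ : I → E} (h : IsEnsemble ρ ψ) (e : J ≃ I) :
    IsEnsemble ρ fun j => ψ (e j) where
  summable := h.summable.comp_injective e.injective
  hasSum := (e.hasSum_iff (f := fun i => rankOne ℂ (ψ i) (ψ i))).2 h.hasSum

/-- `‖ψ‖²` as an extended nonnegative real. -/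
def normSq {E : Type*} [NormedAddCommGroup E] (ψ : E) : ENNReal := ENNReal.ofReal (‖ψ‖ ^ 2)

theorem IsEnsemble.tsum_normSq {E : Type*} [NormedAddCommGroup E] [InnerProductSpace ℂ E]
    [CompleteSpace E] {I : Type*} {ρ : Op E} {ψ : I → E} (h : IsEnsemble ρ ψ) :
    ∑' i, normSq (ψ i) = ENNReal.ofReal (trace ρ).re := by
  rw [← h.hasSum_trace.tsum_eq, ENNReal.ofReal_tsum_of_nonneg (fun _ => by positivity) h.summable]
  rfl

theorem Channel.tsum_normSq {E : Type*} [NormedAddCommGroup E] [InnerProductSpace ℂ E]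
    [CompleteSpace E] (C : Channel E) (ψ : E) : ∑' k, normSq (C.kraus k ψ) = normSq ψ := by
  rw [normSq, ← (C.tracePreserving ψ).tsum_eq,
    ENNReal.ofReal_tsum_of_nonneg (fun _ => by positivity) (C.tracePreserving ψ).summable]
  rfl

theorem normSq_mono {E F : Type*} [NormedAddCommGroup E] [NormedAddCommGroup F] {x : E} {y : F}
    (h : ‖x‖ ≤ ‖y‖) : normSq x ≤ normSq y :=
  ENNReal.ofReal_le_ofReal (pow_le_pow_left₀ (norm_nonneg _) h 2)

namespace ExitProgram

variable {H : Type*} [NormedAddCommGroup H] [InnerProductSpace ℂ H] [CompleteSpace H]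
variable {L : Type*} (π : ExitProgram H L)

theorem sum_norm_sq_meas (l : L) (x : H) : ∑ j, ‖π.meas l j x‖ ^ 2 = ‖x‖ ^ 2 := by
  have h := congrArg (fun A : Op H => (⟪x, A x⟫_ℂ).re) (π.meas_complete l)
  simpa [sum_apply, inner_sum, adjoint_inner_right, inner_self_eq_norm_sq_to_K,
    ← Complex.ofReal_pow] using h

variable [Fintype L] {p q : ClosedSubmodule ℂ (Joint H L)}
variable {I : Type*} {ψ : I → Joint H L} {σ τ : Op (Joint H L)}

/-- The Kraus operators of one step of the program, indexed by the measurement outcome, the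
location and the Kraus index of the super-operator of this location. -/
def stepKraus (v : Fin (π.N + 1) × L × ℕ) : Op (Joint H L) :=
  adjoint (bra (π.goto v.1 v.2.1)) ∘L π.meas v.2.1 v.1 ∘L (π.act v.2.1).kraus v.2.2 ∘L bra v.2.1

theorem isEnsemble_step (h : IsEnsemble σ ψ) :
    IsEnsemble (π.step σ) fun x : (Fin (π.N + 1) × L × ℕ) × I => π.stepKraus x.1 (ψ x.2) := by
  have key : IsEnsemble (π.step σ) fun x : Fin (π.N + 1) × L × ℕ × I =>
      π.stepKraus (x.1, x.2.1, x.2.2.1) (ψ x.2.2.2) := by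
    refine .sum fun j => .sum fun l => ?_
    rw [ketbra_eq_sandwich]
    exact (((h.sandwich (bra l)).apply (π.act l)).1.sandwich (π.meas l j)).sandwich _
  exact key.comp_equiv ((Equiv.prodAssoc _ _ _).trans
    ((Equiv.refl _).prodCongr (Equiv.prodAssoc _ _ _)))

theorem isTraceClass_step (h : IsTraceClass σ) : IsTraceClass (π.step σ) :=
  let ⟨_, hψ⟩ := h
  (π.isEnsemble_step hψ).isTraceClass

theorem step_add (hσ : IsTraceClass σ) (hτ : IsTraceClass τ) :
    π.step (σ + τ) = π.step σ + π.step τ := by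
  simp only [step, ← Finset.sum_add_distrib, ketbra_eq_sandwich]
  refine Finset.sum_congr rfl fun j _ => Finset.sum_congr rfl fun l _ => ?_
  have h1 : sandwich (bra l) (σ + τ) = sandwich (bra l) σ + sandwich (bra l) τ := by
    simp [sandwich]
  rw [h1, (hσ.sandwich _).apply_add (hτ.sandwich _)]
  simp [sandwich]

theorem step_zero : π.step 0 = 0 := by
  simp [step, sandwich, Channel.apply, ketbra]

theorem denote_body (σ : Op (Joint H L)) : denote π.body σ = π.step σ :=
  denote_apply _ _

variable [DecidableEq L]

theorem tsum_normSq_stepKraus (ψ : Joint H L) :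
    ∑' v, normSq (π.stepKraus v ψ) = normSq ψ := by
  have h1 : ∀ l k, ∑ j, normSq (π.stepKraus (j, l, k) ψ) =
      normSq ((π.act l).kraus k (bra l ψ)) := by
    intro l k
    rw [normSq, ← π.sum_norm_sq_meas l, ENNReal.ofReal_sum_of_nonneg fun _ _ => by positivity]
    refine Finset.sum_congr rfl fun j _ => ?_
    rw [normSq, stepKraus]
    simp only [coe_comp, Function.comp_apply, norm_adjoint_bra]
  rw [ENNReal.tsum_prod', ENNReal.tsum_comm, ENNReal.tsum_prod']
  simp only [tsum_fintype, h1, Channel.tsum_normSq]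
  rw [normSq, norm_sq_eq_sum_bra, ENNReal.ofReal_sum_of_nonneg fun _ _ => by positivity]
  rfl

/-- Each Kraus operator reads only one location, hence it either ignores the location projection or
is killed by it. This keeps weakest preconditions inside `AP`. -/
theorem stepKraus_ketbra (v : Fin (π.N + 1) × L × ℕ) (l : L) (ψ : Joint H L) :
    π.stepKraus v (ketbra 1 l l ψ) = π.stepKraus v ψ ∨ π.stepKraus v (ketbra 1 l l ψ) = 0 := by
  simp only [stepKraus, coe_comp, Function.comp_apply, bra_ketbra, one_apply_eq_self]
  split_ifs with h
  · rw [h]; exact Or.inl rfl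
  · simp

/-- The two sums are interchanged in `ENNReal`, where no summability is required; trace class makes
both traces nonnegative reals, so nothing is lost. -/
theorem trace_step (h : IsTraceClass σ) : trace (π.step σ) = trace σ := by
  have h' := π.isTraceClass_step h
  refine Complex.ext ?_ (by rw [h'.trace_im, h.trace_im])
  rw [← ENNReal.ofReal_eq_ofReal_iff h'.trace_nonneg h.trace_nonneg]
  obtain ⟨ψ, hψ⟩ := h
  rw [← (π.isEnsemble_step hψ).tsum_normSq, ← hψ.tsum_normSq, ENNReal.tsum_prod',
    ENNReal.tsum_comm]
  simp only [tsum_normSq_stepKraus]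

theorem step_mem (h : σ ∈ PartialDensity (Joint H L)) : π.step σ ∈ PartialDensity (Joint H L) :=
  (π.isTraceClass_step (isTraceClass_of_mem h)).mem_partialDensity
    (by rw [π.trace_step (isTraceClass_of_mem h)]; exact h.2.2)

/-- One iteration of the loop on the part of the state that passes the guard. -/
def loopStep (σ : Op (Joint H L)) : Op (Joint H L) := π.step (sandwich π.M₁ σ)

theorem sandwich_bra_sandwich_M₁ (l : L) (σ : Op (Joint H L)) :
    sandwich (bra l) (sandwich π.M₁ σ) = if l = π.exit then 0 else sandwich (bra l) σ := by
  have h : (bra l ∘L π.M₁ : Joint H L →L[ℂ] H) = if l = π.exit then 0 else bra l := by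
    ext ψ
    rw [comp_apply, bra_M₁]
    split_ifs <;> rfl
  rw [sandwich_sandwich, h]
  split_ifs
  · simp [sandwich]
  · rfl

/-- The exit summand of the step is the identity on the exit block, and the remaining summands do
not see the component removed by `M₁`. Partial density is needed since the exit super-operator is
only known to be trivial on such operators. -/
theorem step_eq (h : σ ∈ PartialDensity (Joint H L)) :
    π.step σ = π.loopStep σ + sandwich π.M₀ σ := by
  have hmem : sandwich (bra π.exit) σ ∈ PartialDensity H := by
    have := isTraceClass_of_mem h
    exact (this.sandwich _).mem_partialDensity
      ((this.trace_sandwich_le (norm_bra_le _)).trans h.2.2)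
  have hM : sandwich π.M₀ σ = ketbra (sandwich (bra π.exit) σ) π.exit π.exit := by
    simp [sandwich, M₀, ketbra, adjoint_comp, one_def, comp_assoc]
  have hexit : ∑ j, ketbra (sandwich (π.meas π.exit j)
      ((π.act π.exit).apply (sandwich (bra π.exit) σ)))
        (π.goto j π.exit) (π.goto j π.exit) = sandwich π.M₀ σ := by
    rw [hM, Finset.sum_eq_single 0]
    · rw [π.act_exit _ hmem, π.goto_exit, π.meas_exit, if_pos rfl]
      congr 1
      ext x
      simp [sandwich, ← star_eq_adjoint]
    · intro j _ hj
      rw [π.meas_exit, if_neg hj]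
      simp [sandwich, ketbra]
    · simp
  rw [← hexit, loopStep, step, step, ← Finset.sum_add_distrib]
  refine Finset.sum_congr rfl fun j _ => ?_
  rw [← Finset.sum_erase_add _ _ (Finset.mem_univ π.exit),
    ← Finset.sum_erase_add (a := π.exit) Finset.univ (fun l => ketbra (sandwich (π.meas l j)
      ((π.act l).apply (sandwich (bra l) (sandwich π.M₁ σ)))) (π.goto j l) (π.goto j l))
      (Finset.mem_univ π.exit)]
  congr 1
  rw [sandwich_bra_sandwich_M₁, if_pos rfl]
  have h0 : ketbra (sandwich (π.meas π.exit j) ((π.act π.exit).apply 0))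
      (π.goto j π.exit) (π.goto j π.exit) = 0 := by
    simp [sandwich, ketbra, Channel.apply]
  rw [h0, add_zero]
  refine Finset.sum_congr rfl fun l hl => ?_
  rw [sandwich_bra_sandwich_M₁, if_neg (Finset.ne_of_mem_erase hl)]

theorem sandwich_M₀_mem (h : σ ∈ PartialDensity (Joint H L)) :
    sandwich π.M₀ σ ∈ PartialDensity (Joint H L) :=
  ((isTraceClass_of_mem h).sandwich _).mem_partialDensity
    (((isTraceClass_of_mem h).trace_sandwich_le π.norm_M₀_le).trans h.2.2)

theorem sandwich_M₁_mem (h : σ ∈ PartialDensity (Joint H L)) :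
    sandwich π.M₁ σ ∈ PartialDensity (Joint H L) :=
  ((isTraceClass_of_mem h).sandwich _).mem_partialDensity
    (((isTraceClass_of_mem h).trace_sandwich_le π.norm_M₁_le).trans h.2.2)

theorem loopStep_mem (h : σ ∈ PartialDensity (Joint H L)) :
    π.loopStep σ ∈ PartialDensity (Joint H L) :=
  π.step_mem (π.sandwich_M₁_mem h)

theorem iterate_loopStep_mem (h : σ ∈ PartialDensity (Joint H L)) (n : ℕ) :
    π.loopStep^[n] σ ∈ PartialDensity (Joint H L) := by
  induction n with
  | zero => exact h
  | succ n ih => rw [Function.iterate_succ_apply']; exact π.loopStep_mem ih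

theorem sandwich_M₁_sandwich_M₀ (σ : Op (Joint H L)) : sandwich π.M₁ (sandwich π.M₀ σ) = 0 := by
  have h : π.M₁ ∘L π.M₀ = 0 := by
    ext1 ψ
    exact π.mem_exitSpace.1 (π.M₀_mem_exitSpace ψ)
  rw [sandwich_sandwich, h]
  simp [sandwich]

theorem sandwich_M₀_sandwich_M₀ (σ : Op (Joint H L)) :
    sandwich π.M₀ (sandwich π.M₀ σ) = sandwich π.M₀ σ := by
  have h : π.M₀ ∘L π.M₀ = π.M₀ := by
    ext1 ψ
    exact π.eq_M₀_of_mem_exitSpace (π.M₀_mem_exitSpace ψ)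
  rw [sandwich_sandwich, h]

theorem step_sandwich_M₀ (h : σ ∈ PartialDensity (Joint H L)) :
    π.step (sandwich π.M₀ σ) = sandwich π.M₀ σ := by
  rw [π.step_eq (π.sandwich_M₀_mem h), loopStep, sandwich_M₁_sandwich_M₀, step_zero, zero_add,
    sandwich_M₀_sandwich_M₀]

theorem trace_sandwich_M₀ (h : IsTraceClass σ) :
    (trace (sandwich π.M₀ σ)).re = (trace σ).re - (trace (π.loopStep σ)).re := by
  rw [loopStep, π.trace_step (h.sandwich _)]
  obtain ⟨ψ, hψ⟩ := h
  have h1 := (hψ.sandwich π.M₀).hasSum_trace.add (hψ.sandwich π.M₁).hasSum_trace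
  simp only [norm_sq_M₀_add_norm_sq_M₁] at h1
  rw [hψ.hasSum_trace.unique h1]
  ring

theorem isTraceClass_iterate (h : σ ∈ PartialDensity (Joint H L)) (n : ℕ) :
    IsTraceClass (π.loopStep^[n] σ) :=
  isTraceClass_of_mem (π.iterate_loopStep_mem h n)

/-- Telescoping: each round preserves trace apart from what leaves through `M₀`. -/
theorem sum_trace_exited (h : σ ∈ PartialDensity (Joint H L)) (n : ℕ) :
    ∑ m ∈ Finset.range n, (trace (sandwich π.M₀ (π.loopStep^[m] σ))).re =
      (trace σ).re - (trace (π.loopStep^[n] σ)).re := by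
  induction n with
  | zero => simp
  | succ n ih =>
    rw [Finset.sum_range_succ, ih, π.trace_sandwich_M₀ (π.isTraceClass_iterate h n),
      Function.iterate_succ_apply']
    ring

theorem antitone_trace_iterate (h : σ ∈ PartialDensity (Joint H L)) :
    Antitone fun n => (trace (π.loopStep^[n] σ)).re := by
  refine antitone_nat_of_succ_le fun n => ?_
  have h1 := π.trace_sandwich_M₀ (π.isTraceClass_iterate h n)
  have h2 := ((π.isTraceClass_iterate h n).sandwich π.M₀).trace_nonneg
  rw [Function.iterate_succ_apply']
  linarith

/-- Mass that has exited is fixed by the step, while the remainder evolves by `loopStep` and sheds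
one new exited piece per round. -/
theorem iterate_step_eq (h : σ ∈ PartialDensity (Joint H L)) (n : ℕ) :
    π.step^[n] σ = π.loopStep^[n] σ +
      ∑ m ∈ Finset.range n, sandwich π.M₀ (π.loopStep^[m] σ) := by
  have hfix : ∀ n, π.step (∑ m ∈ Finset.range n, sandwich π.M₀ (π.loopStep^[m] σ)) =
      ∑ m ∈ Finset.range n, sandwich π.M₀ (π.loopStep^[m] σ) := by
    intro n
    induction n with
    | zero => simp [step_zero]
    | succ n ih =>
      rw [Finset.sum_range_succ, π.step_add
        (.sum fun m => (π.isTraceClass_iterate h m).sandwich _)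
        ((π.isTraceClass_iterate h n).sandwich _), ih,
        π.step_sandwich_M₀ (π.iterate_loopStep_mem h n)]
  induction n with
  | zero => simp
  | succ n ih =>
    rw [Function.iterate_succ_apply', ih, π.step_add (π.isTraceClass_iterate h n)
      (.sum fun m => (π.isTraceClass_iterate h m).sandwich _), hfix,
      π.step_eq (π.iterate_loopStep_mem h n), Finset.sum_range_succ, Function.iterate_succ_apply']
    abel

theorem denote_whileForm (σ : Op (Joint H L)) :
    denote π.whileForm σ = ∑' n, sandwich π.M₀ (π.loopStep^[n] σ) :=
  denote_loop _ _ _ _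

theorem summable_trace_exited (h : σ ∈ PartialDensity (Joint H L)) :
    Summable fun n => (trace (sandwich π.M₀ (π.loopStep^[n] σ))).re := by
  refine summable_of_sum_range_le (c := (trace σ).re)
    (fun n => ((π.isTraceClass_iterate h n).sandwich _).trace_nonneg) fun n => ?_
  rw [π.sum_trace_exited h]
  linarith [(π.isTraceClass_iterate h n).trace_nonneg]

theorem sat_denote_whileForm_iff (h : σ ∈ PartialDensity (Joint H L)) :
    Sat (denote π.whileForm σ) q ↔ ∀ n, Sat (π.loopStep^[n] σ) (q.comap π.M₀) := by
  rw [denote_whileForm, (IsTraceClass.tsum (fun n => (π.isTraceClass_iterate h n).sandwich _)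
    (π.summable_trace_exited h)).2.2]
  simp only [(π.isTraceClass_iterate h _).sat_sandwich_iff]

/-- The output trace is `tr σ` minus the limit of the trace still in the loop. -/
theorem trace_denote_whileForm_iff (h : σ ∈ PartialDensity (Joint H L)) :
    trace (denote π.whileForm σ) = trace σ ↔
      Tendsto (fun n => (trace (π.loopStep^[n] σ)).re) atTop (𝓝 0) := by
  obtain ⟨h1, h2, -⟩ := IsTraceClass.tsum (fun n => (π.isTraceClass_iterate h n).sandwich π.M₀)
    (π.summable_trace_exited h)
  rw [← denote_whileForm] at h1 h2
  have h3 := h2.tendsto_sum_nat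
  simp only [π.sum_trace_exited h] at h3
  have h4 : Tendsto (fun n => (trace (π.loopStep^[n] σ)).re) atTop
      (𝓝 ((trace σ).re - (trace (denote π.whileForm σ)).re)) := by
    simpa using h3.const_sub (trace σ).re
  constructor
  · intro he
    simpa [he] using h4
  · intro ht
    refine Complex.ext ?_ (by rw [h1.trace_im, (isTraceClass_of_mem h).trace_im])
    linarith [tendsto_nhds_unique h4 ht]

end ExitProgram

end QTLogic

end

noncomputable section

namespace QTLogic

open InnerProductSpace ContinuousLinearMap Filter
open scoped Topology

universe u v

/-! ### Weakest preconditions, soundness and completeness. -/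

namespace ExitProgram

variable {H : Type u} [NormedAddCommGroup H] [InnerProductSpace ℂ H] [CompleteSpace H]
variable {L : Type v} [Fintype L] [DecidableEq L]
variable (π : ExitProgram H L) {p q P R : ClosedSubmodule ℂ (Joint H L)}
variable {σ : Op (Joint H L)}

/-- The squared norm of what remains of `ψ` inside the loop after `n` iterations. -/
def weight : ℕ → Joint H L → ENNReal
  | 0, ψ => normSq ψ
  | n + 1, ψ => ∑' v, weight n (π.stepKraus v (π.M₁ ψ))

theorem weight_le (n : ℕ) (ψ : Joint H L) : π.weight n ψ ≤ normSq ψ := by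
  induction n generalizing ψ with
  | zero => exact le_rfl
  | succ n ih =>
    calc π.weight (n + 1) ψ ≤ ∑' v, normSq (π.stepKraus v (π.M₁ ψ)) :=
          ENNReal.tsum_le_tsum fun v => ih _
      _ = normSq (π.M₁ ψ) := π.tsum_normSq_stepKraus _
      _ ≤ normSq ψ := normSq_mono (π.norm_M₁_le ψ)

theorem weight_zero (n : ℕ) : π.weight n 0 = 0 :=
  le_antisymm ((π.weight_le n 0).trans (by simp [normSq])) (zero_le)

/-- The bound `‖a + b‖² ≤ 2‖a‖² + 2‖b‖²` passes through linear Kraus operators with the same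
constant for all `n`; this makes almost sure termination a linear condition. -/
theorem weight_add_le (n : ℕ) (ψ φ : Joint H L) :
    π.weight n (ψ + φ) ≤ 2 * π.weight n ψ + 2 * π.weight n φ := by
  induction n generalizing ψ φ with
  | zero =>
    simp only [weight, normSq]
    have h2 : ∀ x : ℝ, 2 * ENNReal.ofReal x = ENNReal.ofReal (2 * x) := fun x => by
      rw [ENNReal.ofReal_mul zero_le_two, ENNReal.ofReal_ofNat]
    rw [h2, h2, ← ENNReal.ofReal_add (by positivity) (by positivity)]
    refine ENNReal.ofReal_le_ofReal ?_
    have h := pow_le_pow_left₀ (norm_nonneg _) (norm_add_le ψ φ) 2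
    nlinarith [sq_nonneg (‖ψ‖ - ‖φ‖)]
  | succ n ih =>
    simp only [weight, map_add, ← ENNReal.tsum_mul_left, ← ENNReal.tsum_add]
    exact ENNReal.tsum_le_tsum fun v => ih _ _

theorem weight_smul (n : ℕ) (a : ℂ) (ψ : Joint H L) :
    π.weight n (a • ψ) = ENNReal.ofReal (‖a‖ ^ 2) * π.weight n ψ := by
  induction n generalizing ψ with
  | zero =>
    simp only [weight, normSq]
    rw [norm_smul, mul_pow, ENNReal.ofReal_mul (by positivity)]
  | succ n ih => simp only [weight, map_smul, ih, ENNReal.tsum_mul_left]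

theorem weight_ketbra_le (n : ℕ) (l : L) (ψ : Joint H L) :
    π.weight n (ketbra 1 l l ψ) ≤ π.weight n ψ := by
  cases n with
  | zero =>
    refine normSq_mono ?_
    rw [show ketbra 1 l l ψ = adjoint (bra l) (bra l ψ) from rfl, norm_adjoint_bra]
    exact norm_bra_le l ψ
  | succ n =>
    refine ENNReal.tsum_le_tsum fun v => ?_
    rw [M₁_ketbra]
    rcases π.stepKraus_ketbra v l (π.M₁ ψ) with h | h
    · rw [h]
    · rw [h, weight_zero]; exact zero_le

/-- The induction replaces the index type by its product with the Kraus indices; the universe `max u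
v` is stable under this and also contains the basis index of the joint space. -/
theorem tsum_weight (n : ℕ) {I : Type (max u v)} {ψ : I → Joint H L} (h : IsEnsemble σ ψ) :
    ∑' i, π.weight n (ψ i) = ENNReal.ofReal (trace (π.loopStep^[n] σ)).re := by
  induction n generalizing I σ with
  | zero => exact h.tsum_normSq
  | succ n ih =>
    rw [Function.iterate_succ_apply, show π.loopStep σ = π.step (sandwich π.M₁ σ) from rfl,
      ← ih (π.isEnsemble_step (h.sandwich π.M₁)),
      ENNReal.tsum_prod', ENNReal.tsum_comm]
    rfl

/-- The vectors from which the loop terminates with probability `1`. -/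
def terminating : ClosedSubmodule ℂ (Joint H L) where
  carrier := {ψ | Tendsto (fun n => π.weight n ψ) atTop (𝓝 0)}
  zero_mem' := by simp [weight_zero]
  add_mem' {ψ φ} hψ hφ := by
    have h := (ENNReal.Tendsto.const_mul hψ (Or.inr (ENNReal.ofNat_ne_top (n := 2)))).add
      (ENNReal.Tendsto.const_mul hφ (Or.inr (ENNReal.ofNat_ne_top (n := 2))))
    rw [mul_zero, add_zero] at h
    exact tendsto_of_tendsto_of_tendsto_of_le_of_le tendsto_const_nhds h (fun _ => zero_le)
      fun n => π.weight_add_le n ψ φ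
  smul_mem' a ψ hψ := by
    have h := ENNReal.Tendsto.const_mul hψ (Or.inr (ENNReal.ofReal_ne_top (r := ‖a‖ ^ 2)))
    rw [mul_zero] at h
    simpa only [Set.mem_ofPred_eq, weight_smul] using h
  isClosed' := by
    rw [← isSeqClosed_iff_isClosed]
    intro φ ψ hφ hlim
    rw [Set.mem_ofPred_eq, ENNReal.tendsto_atTop_zero]
    intro ε hε
    -- Since `weight n ≤ normSq` for every `n`, one close approximant `φ m` controls the weights of
    -- `ψ` uniformly in `n`.
    have hd : Tendsto (fun m => 2 * normSq (ψ - φ m)) atTop (𝓝 0) := by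
      have h1 : Tendsto (fun m => ‖ψ - φ m‖ ^ 2) atTop (𝓝 0) := by
        simpa using ((tendsto_const_nhds (x := ψ)).sub hlim).norm.pow 2
      have h2 := ENNReal.tendsto_ofReal h1
      rw [ENNReal.ofReal_zero] at h2
      have h3 := ENNReal.Tendsto.const_mul h2 (Or.inr (ENNReal.ofNat_ne_top (n := 2)))
      rwa [mul_zero] at h3
    have hε2 : 0 < ε / 2 := ENNReal.half_pos hε.ne'
    obtain ⟨m, hm⟩ := (ENNReal.tendsto_atTop_zero.1 hd) _ hε2
    have hw : Tendsto (fun n => 2 * π.weight n (φ m)) atTop (𝓝 0) := by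
      simpa using ENNReal.Tendsto.const_mul (hφ m) (Or.inr (ENNReal.ofNat_ne_top (n := 2)))
    obtain ⟨N, hN⟩ := (ENNReal.tendsto_atTop_zero.1 hw) _ hε2
    refine ⟨N, fun n hn => ?_⟩
    calc π.weight n ψ = π.weight n (φ m + (ψ - φ m)) := by rw [add_sub_cancel]
      _ ≤ 2 * π.weight n (φ m) + 2 * π.weight n (ψ - φ m) := π.weight_add_le _ _ _
      _ ≤ ε / 2 + ε / 2 := add_le_add (hN n hn)
        ((mul_le_mul_right (π.weight_le n _) 2).trans (hm m le_rfl))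
      _ = ε := ENNReal.add_halves ε

theorem mem_terminating {ψ : Joint H L} :
    ψ ∈ π.terminating ↔ Tendsto (fun n => π.weight n ψ) atTop (𝓝 0) :=
  Iff.rfl

theorem terminating_mem_AP : π.terminating ∈ AP H L :=
  mem_AP_iff.2 fun _ hψ l => tendsto_of_tendsto_of_tendsto_of_le_of_le tendsto_const_nhds hψ
    (fun _ => zero_le) fun n => π.weight_ketbra_le n l _

/-- The remaining trace is the sum of the weights of the ensemble. Dominated convergence with bound
`‖ψᵢ‖²` gives one direction; for the other, each weight is at most the sum. -/
theorem sat_terminating_iff (h : σ ∈ PartialDensity (Joint H L)) :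
    Sat σ π.terminating ↔ Tendsto (fun n => (trace (π.loopStep^[n] σ)).re) atTop (𝓝 0) := by
  obtain ⟨ψ, hψ⟩ := isTraceClass_of_mem h
  have hne : ∀ n i, π.weight n (ψ i) ≠ ⊤ := fun n i =>
    ne_top_of_le_ne_top ENNReal.ofReal_ne_top (π.weight_le n (ψ i))
  have htr : ∀ n, (trace (π.loopStep^[n] σ)).re = ∑' i, (π.weight n (ψ i)).toReal := fun n => by
    rw [← ENNReal.tsum_toReal_eq (hne n), π.tsum_weight n hψ,
      ENNReal.toReal_ofReal (π.isTraceClass_iterate h n).trace_nonneg]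
  rw [hψ.sat_iff]
  simp only [mem_terminating]
  constructor
  · intro hT
    simp only [htr]
    rw [← tsum_zero (β := basisIndex (Joint H L))]
    refine tendsto_tsum_of_dominated_convergence hψ.summable (fun i => ?_)
      (Eventually.of_forall fun n i => ?_)
    · exact (ENNReal.tendsto_toReal ENNReal.zero_ne_top).comp (hT i)
    · rw [Real.norm_of_nonneg ENNReal.toReal_nonneg]
      exact ENNReal.toReal_le_of_le_ofReal (by positivity) (π.weight_le n (ψ i))
  · intro ht i
    have ht' := ENNReal.tendsto_ofReal ht
    rw [ENNReal.ofReal_zero] at ht'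
    refine tendsto_of_tendsto_of_tendsto_of_le_of_le tendsto_const_nhds ht'
      (fun _ => zero_le) fun n => ?_
    rw [← π.tsum_weight n hψ]
    exact ENNReal.le_tsum i

/-- The weakest precondition of one iteration of the loop. -/
def preLoop (R : ClosedSubmodule ℂ (Joint H L)) : ClosedSubmodule ℂ (Joint H L) :=
  ⨅ v, R.comap (π.stepKraus v ∘L π.M₁)

theorem preLoop_mem_AP : π.preLoop R ∈ AP H L := by
  refine iInf_mem_AP fun v => comap_mem_AP fun ψ l h => ?_
  rw [comp_apply, M₁_ketbra]
  rcases π.stepKraus_ketbra v l (π.M₁ ψ) with h' | h'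
  · rwa [h']
  · rw [h']; exact R.toSubmodule.zero_mem

/-- After one iteration the ensemble consists of all Kraus images of the old vectors, so the
preimage under every Kraus operator is needed. -/
theorem sat_loopStep_iff (h : IsTraceClass σ) : Sat (π.loopStep σ) R ↔ Sat σ (π.preLoop R) := by
  obtain ⟨ψ, hψ⟩ := h
  rw [loopStep, (π.isEnsemble_step (hψ.sandwich π.M₁)).sat_iff, hψ.sat_iff]
  simp only [preLoop, ClosedSubmodule.mem_iInf, ClosedSubmodule.mem_comap, comp_apply]
  rw [Prod.forall, forall_comm]

theorem sat_iterate_loopStep_iff (h : σ ∈ PartialDensity (Joint H L)) (n : ℕ) :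
    Sat (π.loopStep^[n] σ) R ↔ Sat σ (π.preLoop^[n] R) := by
  induction n generalizing σ with
  | zero => rfl
  | succ n ih =>
    rw [Function.iterate_succ_apply, ih (π.loopStep_mem h),
      π.sat_loopStep_iff (isTraceClass_of_mem h), Function.iterate_succ_apply']

/-- The weakest liberal precondition of the while-program with respect to `q`. -/
def wlp (q : ClosedSubmodule ℂ (Joint H L)) : ClosedSubmodule ℂ (Joint H L) :=
  ⨅ n, π.preLoop^[n] (q.comap π.M₀)

theorem wlp_mem_AP (hq : q ∈ AP H L) : π.wlp q ∈ AP H L := by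
  refine iInf_mem_AP fun n => ?_
  cases n with
  | zero => exact π.comap_M₀_mem_AP hq
  | succ n => rw [Function.iterate_succ_apply']; exact π.preLoop_mem_AP

theorem wlp_le : π.wlp q ≤ q.comap π.M₀ := iInf_le _ 0

theorem sat_wlp_iff (h : σ ∈ PartialDensity (Joint H L)) :
    Sat σ (π.wlp q) ↔ ∀ n, Sat (π.loopStep^[n] σ) (q.comap π.M₀) := by
  simp only [π.sat_iterate_loopStep_iff h]
  exact le_iInf_iff

theorem validPar_iff : ValidPar π.whileForm P q ↔ P ≤ π.wlp q := by
  rw [← forall_sat_iff_le]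
  refine forall₂_congr fun σ h => ?_
  rw [π.sat_denote_whileForm_iff h, π.sat_wlp_iff h]

theorem validTot_iff : ValidTot π.whileForm P q ↔ P ≤ π.wlp q ⊓ π.terminating := by
  rw [← forall_sat_iff_le]
  refine forall₂_congr fun σ h => ?_
  rw [π.sat_denote_whileForm_iff h, π.trace_denote_whileForm_iff h, ← π.sat_wlp_iff h,
    ← π.sat_terminating_iff h, Sat, Sat, Sat, Sat, le_inf_iff]

theorem validPar_of_proves {S : QWhile (Joint H L)} (h : π.ProvesPar S P q) : ValidPar S P q := by
  induction h with
  | basic _ _ h => exact h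
  | @invariant p q _ _ _ ih =>
    intro σ hσ hs
    have hinv : ∀ n, Sat (π.loopStep^[n] σ) (π.inv p q) := by
      intro n
      induction n with
      | zero => exact hs
      | succ n ihn =>
        rw [Function.iterate_succ_apply', loopStep, ← denote_body]
        refine ih _ (π.sandwich_M₁_mem (π.iterate_loopStep_mem hσ n)) ?_
        rw [(π.isTraceClass_iterate hσ n).sat_sandwich_iff]
        exact le_trans ihn (π.inv_eq.le.trans inf_le_right)
    rw [π.sat_denote_whileForm_iff hσ]
    exact fun n => le_trans (hinv n) (π.inv_eq.le.trans inf_le_left)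
  | conseq _ _ hP _ hQ ih => exact fun σ hσ hs => le_trans (ih σ hσ (le_trans hs hP)) hQ

/-- If the remaining trace stayed at least `ε`, `t ε` would decrease strictly forever in `ℕ`; once
it falls below `ε`, monotonicity keeps it there. -/
theorem tendsto_of_ranking {r : ClosedSubmodule ℂ (Joint H L)} {t : ℝ → Op (Joint H L) → ℕ}
    (ht : ∀ ε : ℝ, 0 < ε → IsRanking π.body π.M₁ r ε (t ε))
    (hσ : σ ∈ PartialDensity (Joint H L)) (hs : Sat σ r) :
    (∀ n, Sat (π.loopStep^[n] σ) r) ∧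
      Tendsto (fun n => (trace (π.loopStep^[n] σ)).re) atTop (𝓝 0) := by
  have hstep : ∀ ε, 0 < ε → ∀ τ ∈ PartialDensity (Joint H L), Sat τ r → Sat (π.loopStep τ) r ∧
      t ε (π.loopStep τ) ≤ t ε τ ∧ (ε ≤ (trace τ).re → t ε (π.loopStep τ) < t ε τ) := by
    intro ε hε τ hτ hs
    simpa only [denote_body, loopStep] using ht ε hε τ hτ hs
  have hr : ∀ n, Sat (π.loopStep^[n] σ) r := by
    intro n
    induction n with
    | zero => exact hs
    | succ n ih =>
      rw [Function.iterate_succ_apply']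
      exact (hstep 1 one_pos _ (π.iterate_loopStep_mem hσ n) ih).1
  refine ⟨hr, ?_⟩
  rw [Metric.tendsto_atTop]
  intro ε hε
  obtain ⟨n, hn⟩ : ∃ n, (trace (π.loopStep^[n] σ)).re < ε := by
    by_contra! hcon
    have hlt : ∀ n, t ε (π.loopStep^[n] σ) + n ≤ t ε σ := by
      intro n
      induction n with
      | zero => simp
      | succ n ih =>
        have := (hstep ε hε _ (π.iterate_loopStep_mem hσ n) (hr n)).2.2 (hcon n)
        rw [Function.iterate_succ_apply']
        omega
    have := hlt (t ε σ + 1)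
    omega
  refine ⟨n, fun m hm => ?_⟩
  rw [Real.dist_0_eq_abs, abs_of_nonneg (π.isTraceClass_iterate hσ m).trace_nonneg]
  exact (π.antitone_trace_iterate hσ hm).trans_lt hn

theorem validTot_of_proves {S : QWhile (Joint H L)} (h : π.ProvesTot S P q) : ValidTot S P q := by
  induction h with
  | basic _ _ h => exact h
  | @ranking p q t _ _ _ ht _ =>
    intro σ hσ hs
    obtain ⟨hr, hlim⟩ := π.tendsto_of_ranking ht hσ hs
    rw [π.sat_denote_whileForm_iff hσ, π.trace_denote_whileForm_iff hσ]
    exact ⟨fun n => le_trans (hr n) (π.inv_eq.le.trans inf_le_left), hlim⟩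
  | conseq _ _ hP _ hQ ih =>
    intro σ hσ hs
    obtain ⟨h1, h2⟩ := ih σ hσ (le_trans hs hP)
    exact ⟨le_trans h1 hQ, h2⟩

theorem le_inv (hp : p ∈ AP H L) (hpq : p ≤ q.comap π.M₀) : p ≤ π.inv p q := by
  rw [inv_eq]
  exact le_inf hpq fun ψ hψ => π.M₁_mem hp hψ

/-- The invariant puts only the `M₁` component in `p`, but an iteration depends on that component
alone. -/
theorem sat_loopStep_of_sat_inv
    (hloop : ∀ σ ∈ PartialDensity (Joint H L), Sat σ p → Sat (π.loopStep σ) p)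
    (hσ : σ ∈ PartialDensity (Joint H L)) (hs : Sat σ (π.inv p q)) :
    Sat (π.loopStep σ) p := by
  have h1 : sandwich π.M₁ (sandwich π.M₁ σ) = sandwich π.M₁ σ := by
    have h : π.M₁ ∘L π.M₁ = π.M₁ := by
      ext1 ψ
      exact π.eq_M₁_of_mem_runSpace (π.M₁_mem_runSpace ψ)
    rw [sandwich_sandwich, h]
  have h2 := hloop _ (π.sandwich_M₁_mem hσ)
    ((isTraceClass_of_mem hσ).sat_sandwich_iff.2 (le_trans hs (π.inv_eq.le.trans inf_le_right)))
  rwa [loopStep, h1] at h2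

theorem sat_step_inv (hp : p ∈ AP H L) (hpq : p ≤ q.comap π.M₀)
    (hloop : ∀ σ ∈ PartialDensity (Joint H L), Sat σ p → Sat (π.loopStep σ) p)
    (hσ : σ ∈ PartialDensity (Joint H L)) (hs : Sat σ p) :
    Sat (π.step σ) (π.inv p q) := by
  have htc := isTraceClass_of_mem hσ
  rw [π.step_eq hσ, (isTraceClass_of_mem (π.loopStep_mem hσ)).sat_add_iff (htc.sandwich _)]
  refine ⟨le_trans (hloop σ hσ hs) (π.le_inv hp hpq), htc.sat_sandwich_iff.2 (le_trans hs ?_)⟩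
  exact fun ψ hψ => π.le_inv hp hpq (π.M₀_mem hp hψ)

theorem sat_loopStep_wlp (hσ : σ ∈ PartialDensity (Joint H L)) (hs : Sat σ (π.wlp q)) :
    Sat (π.loopStep σ) (π.wlp q) := by
  rw [π.sat_wlp_iff (π.loopStep_mem hσ)]
  exact fun n => (π.sat_wlp_iff hσ).1 hs (n + 1)

theorem sat_loopStep_terminating (hσ : σ ∈ PartialDensity (Joint H L))
    (hs : Sat σ π.terminating) : Sat (π.loopStep σ) π.terminating := by
  rw [π.sat_terminating_iff (π.loopStep_mem hσ)]
  exact (tendsto_add_atTop_iff_nat 1).2 ((π.sat_terminating_iff hσ).1 hs)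

/-- Completeness takes `p = wlp q`: it is preserved by an iteration and its exit component already
lies in `q`, which makes the premise about the body true. -/
theorem provesPar_iff (hP : P ∈ AP H L) (hq : q ∈ AP H L) :
    π.ProvesPar π.whileForm P q ↔ P ≤ π.wlp q := by
  refine ⟨fun h => π.validPar_iff.1 (π.validPar_of_proves h), fun h => ?_⟩
  have hp := π.wlp_mem_AP hq
  refine .conseq hP hq (h.trans (π.le_inv hp π.wlp_le)) (.invariant hp hq ?_) le_rfl
  refine .basic hp (π.inv_mem_AP hp hq) fun σ hσ hs => ?_
  rw [denote_body]
  exact π.sat_step_inv hp π.wlp_le (fun _ => π.sat_loopStep_wlp) hσ hs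

/-- The number of iterations until the probability to be inside the loop drops below `ε`. -/
def rank (ε : ℝ) (σ : Op (Joint H L)) : ℕ := sInf {n | (trace (π.loopStep^[n] σ)).re < ε}

theorem rank_loopStep {ε : ℝ} (hε : 0 < ε) (hσ : σ ∈ PartialDensity (Joint H L))
    (hlim : Tendsto (fun n => (trace (π.loopStep^[n] σ)).re) atTop (𝓝 0)) :
    π.rank ε (π.loopStep σ) ≤ π.rank ε σ ∧
      (ε ≤ (trace σ).re → π.rank ε (π.loopStep σ) < π.rank ε σ) := by
  have hne : {n | (trace (π.loopStep^[n] σ)).re < ε}.Nonempty :=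
    (hlim.eventually_lt_const hε).exists
  have hmem : (trace (π.loopStep^[π.rank ε σ] σ)).re < ε := Nat.sInf_mem hne
  rcases hn : π.rank ε σ with _ | n
  · rw [hn] at hmem
    refine ⟨Nat.sInf_le ?_, fun h => absurd hmem (not_lt.2 h)⟩
    -- At rank `0` the trace is already below `ε`, and it stays so after another iteration.
    exact (π.antitone_trace_iterate hσ (Nat.zero_le 1)).trans_lt hmem
  · rw [hn] at hmem
    have : π.rank ε (π.loopStep σ) ≤ n := Nat.sInf_le hmem
    exact ⟨by omega, fun _ => by omega⟩

theorem provesTot_iff (hP : P ∈ AP H L) (hq : q ∈ AP H L) :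
    π.ProvesTot π.whileForm P q ↔ P ≤ π.wlp q ⊓ π.terminating := by
  refine ⟨fun h => π.validTot_iff.1 (π.validTot_of_proves h), fun h => ?_⟩
  have hp := inf_mem_AP (π.wlp_mem_AP hq) π.terminating_mem_AP
  have hpq : π.wlp q ⊓ π.terminating ≤ q.comap π.M₀ := inf_le_left.trans π.wlp_le
  have hloop : ∀ σ ∈ PartialDensity (Joint H L), Sat σ (π.wlp q ⊓ π.terminating) →
      Sat (π.loopStep σ) (π.wlp q ⊓ π.terminating) := fun σ hσ hs =>
    le_inf (π.sat_loopStep_wlp hσ (le_trans hs inf_le_left))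
      (π.sat_loopStep_terminating hσ (le_trans hs inf_le_right))
  refine .conseq hP hq (h.trans (π.le_inv hp hpq)) (.ranking π.rank hp hq ?_ ?_) le_rfl
  · refine .basic hp (π.inv_mem_AP hp hq) fun σ hσ hs => ?_
    rw [denote_body]
    exact ⟨π.sat_step_inv hp hpq hloop hσ hs, π.trace_step (isTraceClass_of_mem hσ)⟩
  · intro ε hε σ hσ hs
    have h1 := π.sat_loopStep_of_sat_inv hloop hσ hs
    rw [denote_body]
    refine ⟨le_trans h1 (π.le_inv hp hpq), π.rank_loopStep hε hσ ?_⟩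
    -- Only the state after one iteration is known to satisfy `terminating`; shifting the sequence
    -- by one index transfers the limit to `σ`.
    exact (tendsto_add_atTop_iff_nat 1).1 ((π.sat_terminating_iff (π.loopStep_mem hσ)).1
      (le_trans h1 inf_le_right))

end ExitProgram

end QTLogic

end

noncomputable section

namespace QTLogic

open InnerProductSpace ContinuousLinearMap Filter
open scoped Topology

/-! ### Initial states as test states. -/

section States

variable {H : Type*} [NormedAddCommGroup H] [InnerProductSpace ℂ H] [CompleteSpace H]
variable {L : Type*} [Fintype L] [DecidableEq L] {P R : ClosedSubmodule ℂ (Joint H L)}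
variable {σ : Op (Joint H L)}

theorem trace_ketbra {ρ : Op H} (h : IsTraceClass ρ) (l : L) :
    trace (ketbra ρ l l) = trace ρ := by
  rw [ketbra_eq_sandwich]
  refine Complex.ext ?_ (by rw [(h.sandwich _).trace_im, h.trace_im])
  obtain ⟨ψ, hψ⟩ := h
  have h1 := (hψ.sandwich (adjoint (bra l))).hasSum_trace
  simp only [norm_adjoint_bra] at h1
  exact h1.unique hψ.hasSum_trace

theorem states_subset (h : σ ∈ States H L) :
    σ ∈ PartialDensity (Joint H L) ∧ trace σ = 1 := by
  obtain ⟨ρ, hρ, h1, rfl⟩ := h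
  have htc : ∀ l, IsTraceClass (ketbra (ρ l) l l) := fun l => by
    rw [ketbra_eq_sandwich]
    exact (isTraceClass_of_mem (hρ l)).sandwich _
  have htr : trace (∑ l, ketbra (ρ l) l l) = 1 := by
    rw [IsTraceClass.trace_sum htc, ← h1]
    exact Finset.sum_congr rfl fun l _ => trace_ketbra (isTraceClass_of_mem (hρ l)) l
  exact ⟨(IsTraceClass.sum htc).mem_partialDensity (by simp [htr]), htr⟩

theorem ketbra_rankOne_mem_states (l : L) {x : H} (hx : ‖x‖ = 1) :
    ketbra (rankOne ℂ x x) l l ∈ States H L := by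
  have hens := isEnsemble_rankOne x
  have htr : (trace (rankOne ℂ x x)).re = 1 := hens.hasSum_trace.unique (by simp [hx])
  have htr' : trace (rankOne ℂ x x) = 1 := Complex.ext (by simp [htr]) (by simp [hens.trace_im])
  have h0 : trace (0 : Op H) = 0 := by simp [trace]
  refine ⟨fun k => if k = l then rankOne ℂ x x else 0, fun k => ?_, ?_, ?_⟩
  · dsimp only
    split_ifs
    · exact hens.mem_partialDensity htr.le
    · exact IsTraceClass.zero.mem_partialDensity (by simp [h0])
  · simp [apply_ite trace, h0, htr']
  · rw [Finset.sum_eq_single l]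
    · simp
    · intro k _ hk
      simp [hk, ketbra]
    · simp

/-- Admissible states are block-diagonal, so the tests are pure states at a single location; `P ∈
AP` ensures that the location components of a vector of `P` are again in `P`. -/
theorem forall_states_sat_iff_le (hP : P ∈ AP H L) :
    (∀ σ ∈ States H L, Sat σ P → Sat σ R) ↔ P ≤ R := by
  refine ⟨fun h ψ hψ => ?_, fun h σ _ hs => le_trans hs h⟩
  rw [← sum_ketbra_one ψ]
  refine R.toSubmodule.sum_mem fun l _ => ?_
  rcases eq_or_ne (bra l ψ) 0 with h0 | h0
  · rw [show ketbra 1 l l ψ = adjoint (bra l) (bra l ψ) from rfl, h0, map_zero]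
    exact R.toSubmodule.zero_mem
  set c : ℂ := (‖bra l ψ‖ : ℂ) with hc
  have hc0 : c ≠ 0 := by simpa [hc] using h0
  have hu : ‖c⁻¹ • bra l ψ‖ = 1 := by
    rw [norm_smul]
    simp [hc, h0]
  have hk : adjoint (bra l) (c⁻¹ • bra l ψ) = c⁻¹ • ketbra 1 l l ψ := by
    rw [map_smul]
    rfl
  have hens := (isEnsemble_rankOne (c⁻¹ • bra l ψ)).sandwich (adjoint (bra l))
  rw [← ketbra_eq_sandwich, hk] at hens
  have hs := h _ (ketbra_rankOne_mem_states l hu) (hens.sat_iff.2 fun _ =>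
    P.toSubmodule.smul_mem _ (mem_AP_iff.1 hP ψ hψ l))
  have := R.toSubmodule.smul_mem c (hens.sat_iff.1 hs ())
  rwa [smul_smul, mul_inv_cancel₀ hc0, one_smul] at this

end States

/-! ### Temporal formulas along the orbit of a state. -/

namespace ExitProgram

variable {H : Type*} [NormedAddCommGroup H] [InnerProductSpace ℂ H] [CompleteSpace H]
variable {L : Type*} [Fintype L] (π : ExitProgram H L) {q P : ClosedSubmodule ℂ (Joint H L)}
variable {σ : Op (Joint H L)}

theorem validQTL_iff {φ : QTL (Joint H L)} :
    π.ValidQTL P φ ↔ ∀ σ ∈ States H L, Sat σ P → Models (fun i => π.step^[i] σ) φ := by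
  constructor
  · intro h σ hσ hs
    exact h _ hσ hs fun i => Function.iterate_succ_apply' _ _ _
  · intro h w hw hs hstep
    have : w = fun i => π.step^[i] (w 0) := by
      funext i
      induction i with
      | zero => rfl
      | succ i ih => rw [hstep, ih, Function.iterate_succ_apply']
    rw [this]
    exact h _ hw hs

variable [DecidableEq L]

theorem comap_M₀_comap_M₀ : (q.comap π.M₀).comap π.M₀ = q.comap π.M₀ := by
  ext ψ
  change π.M₀ (π.M₀ ψ) ∈ q ↔ π.M₀ ψ ∈ q
  rw [π.eq_M₀_of_mem_exitSpace (π.M₀_mem_exitSpace ψ)]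

theorem comap_M₀_exitSpace_inf : (π.exitSpace ⊓ q).comap π.M₀ = q.comap π.M₀ := by
  ext ψ
  exact ⟨fun h => h.2, fun h => ⟨π.M₀_mem_exitSpace ψ, h⟩⟩

/-- By the decomposition of the orbit, time `n` tests the current loop state and the earlier exited
pieces; the latter were already tested at their own times. -/
theorem forall_sat_iterate_step_iff (h : σ ∈ PartialDensity (Joint H L)) :
    (∀ n, Sat (π.step^[n] σ) (q.comap π.M₀)) ↔ Sat σ (π.wlp q) := by
  have hex : ∀ n, IsTraceClass (sandwich π.M₀ (π.loopStep^[n] σ)) := fun n =>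
    (π.isTraceClass_iterate h n).sandwich _
  rw [π.sat_wlp_iff h]
  simp only [π.iterate_step_eq h, (π.isTraceClass_iterate h _).sat_add_iff (.sum hex),
    IsTraceClass.sat_sum_iff hex, (π.isTraceClass_iterate h _).sat_sandwich_iff,
    comap_M₀_comap_M₀]
  exact ⟨fun hs n => (hs n).1, fun hs n => ⟨hs n, fun m _ => hs m⟩⟩

theorem validQTL_always_iff (hP : P ∈ AP H L) :
    π.ValidQTL P (.always (.atom (q.comap π.M₀))) ↔ P ≤ π.wlp q := by
  rw [validQTL_iff, ← forall_states_sat_iff_le hP]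
  refine forall₂_congr fun σ hσ => imp_congr_right fun _ => ?_
  rw [← π.forall_sat_iterate_step_iff (states_subset hσ).1]
  simp [Models]

theorem proj_M₁_eq_zero (ψ : Joint H L) : proj (π.exitSpace ⊓ q) (π.M₁ ψ) = 0 := by
  rw [proj_eq_zero_iff, Submodule.mem_orthogonal]
  intro u hu
  rw [← π.eq_M₀_of_mem_exitSpace hu.1, PiLp.inner_apply]
  refine Finset.sum_eq_zero fun l _ => ?_
  change ⟪bra l (π.M₀ u), bra l (π.M₁ ψ)⟫_ℂ = 0
  rw [bra_M₀, bra_M₁]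
  split_ifs <;> simp

theorem trace_comp_proj_sandwich_M₀ (h : IsTraceClass σ) :
    (trace (sandwich π.M₀ σ ∘L proj (π.exitSpace ⊓ q))).re =
      (trace (σ ∘L proj (π.exitSpace ⊓ q))).re := by
  rw [(h.sandwich _).trace_comp_proj_eq, h.trace_comp_proj_eq]
  obtain ⟨ψ, hψ⟩ := h
  have h1 := ((hψ.sandwich π.M₀).sandwich (proj (π.exitSpace ⊓ q))).hasSum_trace
  have h2 : ∀ φ, proj (π.exitSpace ⊓ q) (π.M₀ φ) = proj (π.exitSpace ⊓ q) φ := fun φ => by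
    conv_rhs => rw [← π.M₀_add_M₁ φ, map_add, proj_M₁_eq_zero, add_zero]
  simp only [h2] at h1
  exact h1.unique (hψ.sandwich (proj (π.exitSpace ⊓ q))).hasSum_trace

theorem trace_iterate_step_comp_proj (h : σ ∈ PartialDensity (Joint H L)) (n : ℕ) :
    -- The range is `n + 1`: the loop state at time `n` may already have mass at the exit location.
    (trace (π.step^[n] σ ∘L proj (π.exitSpace ⊓ q))).re = ∑ m ∈ Finset.range (n + 1),
      (trace (sandwich π.M₀ (π.loopStep^[m] σ) ∘L proj (π.exitSpace ⊓ q))).re := by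
  have hex : ∀ n, IsTraceClass (sandwich π.M₀ (π.loopStep^[n] σ)) := fun n =>
    (π.isTraceClass_iterate h n).sandwich _
  rw [π.iterate_step_eq h, (π.isTraceClass_iterate h n).trace_comp_add (.sum hex),
    IsTraceClass.trace_comp_sum hex, Finset.sum_range_succ, Complex.add_re, Complex.re_sum,
    π.trace_comp_proj_sandwich_M₀ (π.isTraceClass_iterate h n), add_comm]

/-- The mass in `M₀ ∧ q` is at most the exited mass, which is `1` minus the mass left in the loop.
Approaching `1` therefore forces both deficits to vanish: no exited mass outside `q`, and none left
in the loop. -/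
theorem almostEventually_iff (h : σ ∈ PartialDensity (Joint H L)) (htr : trace σ = 1) :
    (∀ δ : ℝ, 0 < δ → ∃ n, 1 - δ < (trace (π.step^[n] σ ∘L proj (π.exitSpace ⊓ q))).re) ↔
      Sat σ (π.wlp q ⊓ π.terminating) := by
  have hex : ∀ n, IsTraceClass (sandwich π.M₀ (π.loopStep^[n] σ)) := fun n =>
    (π.isTraceClass_iterate h n).sandwich _
  have hsat : Sat σ (π.wlp q ⊓ π.terminating) ↔ Sat σ (π.wlp q) ∧ Sat σ π.terminating :=
    le_inf_iff
  have hsum := π.sum_trace_exited h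
  rw [htr, Complex.one_re] at hsum
  have hwlp : Sat σ (π.wlp q) ↔ ∀ n,
      (trace (sandwich π.M₀ (π.loopStep^[n] σ) ∘L proj (π.exitSpace ⊓ q))).re =
        (trace (sandwich π.M₀ (π.loopStep^[n] σ))).re := by
    simp only [(hex _).trace_comp_proj_eq_iff, (π.isTraceClass_iterate h _).sat_sandwich_iff,
      comap_M₀_exitSpace_inf, π.sat_wlp_iff h]
  rw [hsat, hwlp, π.sat_terminating_iff h]
  simp only [π.trace_iterate_step_comp_proj h]
  have hle : ∀ n, (trace (sandwich π.M₀ (π.loopStep^[n] σ) ∘L proj (π.exitSpace ⊓ q))).re ≤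
      (trace (sandwich π.M₀ (π.loopStep^[n] σ))).re := fun n => (hex n).trace_comp_proj_le _
  have hnn : ∀ n, 0 ≤ (trace (sandwich π.M₀ (π.loopStep^[n] σ) ∘L proj (π.exitSpace ⊓ q))).re :=
    fun n => (hex n).trace_comp_proj_nonneg _
  have htn : ∀ n, 0 ≤ (trace (π.loopStep^[n] σ)).re := fun n =>
    (π.isTraceClass_iterate h n).trace_nonneg
  constructor
  · intro hev
    have hbound : ∀ δ : ℝ, 0 < δ → ∃ k, ∀ m, k ≤ m →
        1 - δ < ∑ i ∈ Finset.range (m + 1),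
          (trace (sandwich π.M₀ (π.loopStep^[i] σ) ∘L proj (π.exitSpace ⊓ q))).re := by
      intro δ hδ
      obtain ⟨k, hk⟩ := hev δ hδ
      exact ⟨k, fun m hm => hk.trans_le (Finset.sum_le_sum_of_subset_of_nonneg
        (Finset.range_mono (by omega)) fun i _ _ => hnn i)⟩
    constructor
    · intro n
      refine le_antisymm (hle n) (le_of_forall_pos_le_add fun δ hδ => ?_)
      obtain ⟨k, hk⟩ := hbound δ hδ
      have h1 := hk (max k n) (le_max_left _ _)
      -- The deficit of round `n` is at most the total deficit up to `max k n`, which is below `δ`.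
      have h2 := Finset.single_le_sum
        (f := fun i => (trace (sandwich π.M₀ (π.loopStep^[i] σ))).re -
          (trace (sandwich π.M₀ (π.loopStep^[i] σ) ∘L proj (π.exitSpace ⊓ q))).re)
        (fun i _ => sub_nonneg.2 (hle i))
        (Finset.mem_range.2 (show n < max k n + 1 by omega))
      rw [Finset.sum_sub_distrib, hsum] at h2
      linarith [htn (max k n + 1)]
    · rw [Metric.tendsto_atTop]
      intro δ hδ
      obtain ⟨k, hk⟩ := hbound δ hδ
      refine ⟨k + 1, fun m hm => ?_⟩
      obtain ⟨m, rfl⟩ : ∃ m', m = m' + 1 := ⟨m - 1, by omega⟩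
      rw [Real.dist_0_eq_abs, abs_of_nonneg (htn _)]
      have h1 := hk m (by omega)
      have h2 := Finset.sum_le_sum fun i (_ : i ∈ Finset.range (m + 1)) => hle i
      rw [hsum] at h2
      linarith
  · rintro ⟨heq, hlim⟩ δ hδ
    obtain ⟨n, hn⟩ := (((tendsto_add_atTop_iff_nat 1).2 hlim).eventually_lt_const hδ).exists
    refine ⟨n, ?_⟩
    simp only [heq, hsum]
    linarith

theorem validQTL_almostEventually_iff (hP : P ∈ AP H L) :
    π.ValidQTL P (.almostEventually (π.exitSpace ⊓ q)) ↔ P ≤ π.wlp q ⊓ π.terminating := by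
  rw [validQTL_iff, ← forall_states_sat_iff_le hP]
  refine forall₂_congr fun σ hσ => imp_congr_right fun _ => ?_
  rw [← π.almostEventually_iff (states_subset hσ).1 (states_subset hσ).2]
  rfl

end ExitProgram

end QTLogic

end

open QTLogic in
theorem mainTheorem12 {H : Type*} [NormedAddCommGroup H] [InnerProductSpace ℂ H]
    [CompleteSpace H] [TopologicalSpace.SeparableSpace H]
    {L : Type*} [Fintype L] [DecidableEq L] (π : ExitProgram H L)
    (P q : ClosedSubmodule ℂ (Joint H L)) (hP : P ∈ AP H L) (hq : q ∈ AP H L) :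
    ((π.ProvesPar π.whileForm P q ↔ ValidPar π.whileForm P q) ∧
      (π.ProvesPar π.whileForm P q ↔
        π.ValidQTL P (.always (.atom (π.runSpace ⊔ (π.exitSpace ⊓ q))))) ∧
      (π.runSpace ≤ q →
        (π.ProvesPar π.whileForm P q ↔ π.ValidQTL P (.always (.atom q))))) ∧
    ((π.ProvesTot π.whileForm P q ↔ ValidTot π.whileForm P q) ∧
      (π.ProvesTot π.whileForm P q ↔
        π.ValidQTL P (.almostEventually (π.exitSpace ⊓ q))) ∧
      (q ≤ π.exitSpace →
        (π.ProvesTot π.whileForm P q ↔ π.ValidQTL P (.almostEventually q)))) := by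
  have hA : π.ProvesPar π.whileForm P q ↔
      π.ValidQTL P (.always (.atom (q.comap π.M₀))) :=
    (π.provesPar_iff hP hq).trans (π.validQTL_always_iff hP).symm
  have hE : π.ProvesTot π.whileForm P q ↔
      π.ValidQTL P (.almostEventually (π.exitSpace ⊓ q)) :=
    (π.provesTot_iff hP hq).trans (π.validQTL_almostEventually_iff hP).symm
  refine ⟨⟨(π.provesPar_iff hP hq).trans π.validPar_iff.symm, ?_, fun h => ?_⟩,
    (π.provesTot_iff hP hq).trans π.validTot_iff.symm, hE, fun h => ?_⟩
  · rwa [π.runSpace_sup_eq]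
  · rwa [π.comap_M₀_eq_of_runSpace_le hq h] at hA
  · rwa [inf_eq_right.2 h] at hE
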